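/- For integers $n,k$ let $\binom{n}{k}=\lim_{z\to 0}\frac{\Gamma(z+n+1)}{\Gamma(z+k+1)\,\Gamma(z+n-k+1)}\in\mathbb{Z}$, and for integers $b_1,\ldots,b_m$ ($m\ge 1$) let likewise $\binom{b_1+\cdots+b_m}{b_1,\ldots,b_m}=\lim_{z\to 0}\frac{\Gamma(z+b_1+\cdots+b_m+1)}{\Gamma(z+b_1+1)\cdots\Gamma(z+b_m+1)}=\prod_{i=1}^{m}\binom{b_i+b_{i+1}+\cdots+b_m}{b_i}$. Let $\varepsilon\in\{-1,1\}$, $\lambda=(\lambda_1,\ldots,\lambda_\ell)\in\mathbb{Z}_{>0}^{\ell}$, $d=\lambda_1+\cdots+\lambda_\ell$, and $s(j)=\lambda_1+\cdots+\lambda_{j-1}$. For $\boldsymbol{n}\in\mathbb{Z}^d$ (negative entries allowed) set $$A_{\lambda,\varepsilon}(\boldsymbol{n})=\sum_{k\in\mathbb{Z}}\varepsilon^k\prod_{j=1}^{\ell}\binom{n_{s(j)+1}+\cdots+n_{s(j)+\lambda_j}-(\lambda_j-1)k}{n_{s(j)+1}-k,\ldots,n_{s(j)+\lambda_j}-k,\,k},$$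 and call this sum finite if only finitely many of its terms are nonzero. **Theorem 3.2.** Suppose that $\ell\ge 2$ and that $\boldsymbol{n}\in\mathbb{Z}^d$ is such that the sum $A_{\lambda,\varepsilon}(\boldsymbol{n})$ is finite. Then $A_{\lambda,\varepsilon}(m\boldsymbol{n})$ is finite for all integers $m\ge 0$, and the following hold. (a) For all primes $p\ge 3$ and all integers $r\ge 1$, $$A_{\lambda,\varepsilon}(p^r\boldsymbol{n})\equiv A_{\lambda,\varepsilon}(p^{r-1}\boldsymbol{n})\pmod{p^{2r}}.$$ If $\varepsilon=1$, then these congruences also hold for $p=2$. (b) If $\max(\lambda_1,\ldots,\lambda_\ell)\le 2$, then, for all primes $p\ge 5$ and all integers $r\ge 1$, $$A_{\lambda,\varepsilon}(p^r\boldsymbol{n})\equiv A_{\lambda,\varepsilon}(p^{r-1}\boldsymbol{n})\pmod{p^{3r}}.$$ -/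

import Mathlib

open Filter Topology

/-- The binomial coefficient `n` over `k` for arbitrary integers `n` and `k`: the value at `z = 0` of
`Γ(z + n + 1) / (Γ(z + k + 1) Γ(z + n - k + 1))`, see `tendsto_intBinom`. It is computed with
`n (n - 1) ⋯ (n - k + 1) / k!` if `k ≥ 0`, with the symmetry `k ↦ n - k` if `k < 0 ≤ n - k`, and it
is `0` if `k < 0` and `n - k < 0`. -/
def intBinom (n k : ℤ) : ℤ :=
  if 0 ≤ k then Ring.choose n k.toNat
  else if 0 ≤ n - k then Ring.choose n (n - k).toNat
  else 0

/-- The multinomial coefficient `b₁ + ⋯ + bₘ` over `b₁, …, bₘ`, for arbitrary integers `bᵢ`, as an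
iterated binomial coefficient. The upper entry is always the sum of the lower ones, so it is not an
argument. By `tendsto_intMultinomial` it is the value at `z = 0` of
`Γ(z + b₁ + ⋯ + bₘ + 1) / (Γ(z + b₁ + 1) ⋯ Γ(z + bₘ + 1))` if `m ≥ 1`. -/
def intMultinomial : List ℤ → ℤ
  | [] => 1
  | b :: bs => intBinom (b + bs.sum) b * intMultinomial bs

section Gamma

theorem eventually_add_int_ne_zero : ∀ᶠ z : ℂ in 𝓝[≠] 0, ∀ m : ℤ, z + m ≠ 0 := by
  have h1 : ∀ᶠ z : ℂ in 𝓝[≠] 0, ‖z‖ < 1 := by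
    refine nhdsWithin_le_nhds ?_
    have := Metric.ball_mem_nhds (0 : ℂ) one_pos
    filter_upwards [this] with z hz
    simpa using hz
  filter_upwards [h1, self_mem_nhdsWithin] with z hz hz0 m hm
  have hzm : z = -(m : ℂ) := eq_neg_of_add_eq_zero_left hm
  have hm1 : ‖(m : ℂ)‖ < 1 := by rw [hzm, norm_neg] at hz; exact hz
  rw [Complex.norm_intCast] at hm1
  have hm0 : m = 0 := by
    have : |m| < 1 := by exact_mod_cast hm1
    exact Int.abs_lt_one_iff.mp this
  apply hz0
  simp [hzm, hm0]

theorem Gamma_ne_zero_of_add_int {z : ℂ} (hz : ∀ m : ℤ, z + m ≠ 0) (m : ℤ) :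
    Complex.Gamma (z + m + 1) ≠ 0 := by
  apply Complex.Gamma_ne_zero
  intro j hj
  apply hz (m + 1 + j)
  push_cast
  linear_combination hj

theorem Gamma_eq_prod_mul {z : ℂ} (hz : ∀ m : ℤ, z + m ≠ 0) (n : ℤ) (k : ℕ) :
    Complex.Gamma (z + n + 1) =
      (∏ i ∈ Finset.range k, (z + (n : ℂ) - i)) * Complex.Gamma (z + (n - k : ℤ) + 1) := by
  induction k with
  | zero => simp
  | succ k ih =>
    rw [ih, Finset.prod_range_succ, mul_assoc]
    congr 1
    have h := Complex.Gamma_add_one (z + (n - k : ℤ)) (hz _)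
    rw [h]
    congr 1
    · push_cast; ring
    · congr 1; push_cast; ring

theorem prod_eq_factorial_mul_choose (n : ℤ) (k : ℕ) :
    ∏ i ∈ Finset.range k, ((n : ℂ) - i) = (k.factorial : ℂ) * (Ring.choose n k : ℤ) := by
  have h := Ring.descPochhammer_eq_factorial_smul_choose n k
  rw [← Polynomial.eval_eq_smeval, descPochhammer_eval_eq_prod_range] at h
  have h2 := congrArg (Int.cast : ℤ → ℂ) h
  push_cast [nsmul_eq_mul] at h2
  exact h2

theorem tendsto_choose_aux (n : ℤ) (k : ℕ) :
    Tendsto (fun z : ℂ => Complex.Gamma (z + n + 1) /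
      (Complex.Gamma (z + (k : ℤ) + 1) * Complex.Gamma (z + (n - k : ℤ) + 1)))
      (𝓝[≠] 0) (𝓝 (Ring.choose n k : ℤ)) := by
  have h1 : Tendsto (fun z : ℂ => (∏ i ∈ Finset.range k, (z + (n : ℂ) - i)) *
      (Complex.Gamma (z + (k : ℤ) + 1))⁻¹) (𝓝[≠] 0) (𝓝 (Ring.choose n k : ℤ)) := by
    have hc : Continuous (fun z : ℂ => (∏ i ∈ Finset.range k, (z + (n : ℂ) - i)) *
        (Complex.Gamma (z + (k : ℤ) + 1))⁻¹) := by
      have := Complex.differentiable_one_div_Gamma.continuous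
      have h2 : Continuous (fun z : ℂ => (Complex.Gamma (z + (k : ℤ) + 1))⁻¹) :=
        this.comp (by fun_prop : Continuous (fun z : ℂ => z + (k : ℤ) + 1))
      exact (by fun_prop : Continuous
        (fun z : ℂ => ∏ i ∈ Finset.range k, (z + (n : ℂ) - i))).mul h2
    have := (hc.tendsto 0).mono_left (nhdsWithin_le_nhds (s := {0}ᶜ))
    convert this using 2
    simp only [zero_add]
    rw [prod_eq_factorial_mul_choose, Int.cast_natCast, Complex.Gamma_nat_eq_factorial]
    field_simp [Nat.cast_ne_zero.mpr (Nat.factorial_ne_zero k)]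
  refine h1.congr' ?_
  filter_upwards [eventually_add_int_ne_zero] with z hz
  rw [Gamma_eq_prod_mul hz n k]
  have := Gamma_ne_zero_of_add_int hz (n - k)
  have := Gamma_ne_zero_of_add_int hz k
  field_simp

/-- `intBinom n k` is the limiting value of the quotient of gamma functions. -/
theorem tendsto_intBinom (n k : ℤ) :
    Tendsto (fun z : ℂ => Complex.Gamma (z + n + 1) /
      (Complex.Gamma (z + k + 1) * Complex.Gamma (z + (n - k : ℤ) + 1)))
      (𝓝[≠] 0) (𝓝 (intBinom n k : ℤ)) := by
  unfold intBinom
  split_ifs with h1 h2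
  · obtain ⟨m, rfl⟩ := Int.eq_ofNat_of_zero_le h1
    simpa using tendsto_choose_aux n m
  · obtain ⟨m, hm⟩ := Int.eq_ofNat_of_zero_le h2
    have hk : k = n - m := by omega
    have := tendsto_choose_aux n m
    rw [hm, hk, Int.toNat_natCast]
    refine this.congr fun z => ?_
    rw [mul_comm (Complex.Gamma (z + (m : ℤ) + 1))]
  · obtain ⟨j, hj⟩ := Int.eq_ofNat_of_zero_le (show 0 ≤ -k by omega)
    have hinv := Complex.differentiable_one_div_Gamma.continuous
    have h3 : Continuous (fun z : ℂ => (Complex.Gamma (z + k + 1))⁻¹) :=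
      hinv.comp (by fun_prop : Continuous (fun z : ℂ => z + k + 1))
    have h4 := h3.tendsto 0
    have hz0 : (Complex.Gamma ((0 : ℂ) + k + 1))⁻¹ = 0 := by
      rw [inv_eq_zero, Complex.Gamma_eq_zero_iff]
      refine ⟨(-k - 1).toNat, ?_⟩
      have : (((-k - 1).toNat : ℤ) : ℂ) = ((-k - 1 : ℤ) : ℂ) := by
        rw [Int.toNat_of_nonneg (by omega)]
      rw [Int.cast_natCast] at this
      rw [this]; push_cast; ring
    rw [hz0] at h4
    have hp : Continuous (fun z : ℂ => ∏ i ∈ Finset.range j, (z + ((n - k : ℤ) : ℂ) - i)) := by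
      fun_prop
    have hne : (∏ i ∈ Finset.range j, ((0 : ℂ) + ((n - k : ℤ) : ℂ) - i)) ≠ 0 := by
      rw [Finset.prod_ne_zero_iff]
      intro i _ hi
      have : (n - k - i : ℤ) = 0 := by
        have h5 : ((n - k - i : ℤ) : ℂ) = 0 := by push_cast at hi ⊢; linear_combination hi
        exact_mod_cast h5
      omega
    have h6 := (h4.mul ((hp.tendsto 0).inv₀ hne)).mono_left (nhdsWithin_le_nhds (s := {0}ᶜ))
    rw [zero_mul] at h6
    rw [Int.cast_zero]
    refine h6.congr' ?_
    filter_upwards [eventually_add_int_ne_zero] with z hz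
    have h7 := Gamma_eq_prod_mul hz (n - k) j
    rw [show (n - k - j : ℤ) = n by omega] at h7
    rw [h7]
    have := Gamma_ne_zero_of_add_int hz n
    rw [div_eq_mul_inv, mul_inv, mul_inv]
    field_simp

/-- `intMultinomial b` is the limiting value of the quotient of gamma functions. -/
theorem tendsto_intMultinomial (b : List ℤ) (hb : b ≠ []) :
    Tendsto (fun z : ℂ => Complex.Gamma (z + b.sum + 1) /
      (b.map fun c : ℤ => Complex.Gamma (z + c + 1)).prod)
      (𝓝[≠] 0) (𝓝 (intMultinomial b : ℤ)) := by
  induction b with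
  | nil => exact absurd rfl hb
  | cons c bs ih =>
    rcases eq_or_ne bs [] with rfl | hbs
    · have h : intMultinomial [c] = 1 := by
        by_cases hc : 0 ≤ c
        · obtain ⟨m, rfl⟩ := Int.eq_ofNat_of_zero_le hc
          simp [intMultinomial, intBinom, Ring.choose_natCast]
        · simp [intMultinomial, intBinom, hc]
      rw [h, Int.cast_one]
      refine (tendsto_const_nhds (x := (1 : ℂ))).congr' ?_
      filter_upwards [eventually_add_int_ne_zero] with z hz
      have := Gamma_ne_zero_of_add_int hz c
      simp [this]
    · have h := (tendsto_intBinom (c + bs.sum) c).mul (ih hbs)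
      simp only [intMultinomial]
      rw [Int.cast_mul]
      refine h.congr' ?_
      filter_upwards [eventually_add_int_ne_zero] with z hz
      have h1 := Gamma_ne_zero_of_add_int hz bs.sum
      rw [show (c + bs.sum - c : ℤ) = bs.sum by ring, List.map_cons, List.prod_cons,
        List.sum_cons]
      field_simp

end Gamma

/-- The product over the blocks `j` of
`(n_{s(j)+1} + ⋯ + n_{s(j)+λ_j} - (λ_j - 1) k)` over
`(n_{s(j)+1} - k, …, n_{s(j)+λ_j} - k, k)`, where `s(j) = λ_1 + ⋯ + λ_{j-1}`.
The index `s(j) + i` (counted from zero) is `finSigmaFinEquiv ⟨j, i⟩`. -/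
def aperyTerm {l : ℕ} (lam : Fin l → ℕ) (n : Fin (∑ j, lam j) → ℤ) (k : ℤ) : ℤ :=
  ∏ j : Fin l, intMultinomial
    (List.ofFn (fun i : Fin (lam j) => n (finSigmaFinEquiv ⟨j, i⟩) - k) ++ [k])

/-- The sum over `k ∈ ℤ` that defines `A_{λ,ε}(n)` has only finitely many nonzero terms. -/
def AperyFinite {l : ℕ} (lam : Fin l → ℕ) (n : Fin (∑ j, lam j) → ℤ) : Prop :=
  {k : ℤ | aperyTerm lam n k ≠ 0}.Finite

/-- `A_{λ,ε}(n) = ∑_{k ∈ ℤ} ε ^ k * aperyTerm lam n k`, for `ε = ±1`, meaningful whenever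
`AperyFinite lam n`. -/
noncomputable def aperyA {l : ℕ} (lam : Fin l → ℕ) (ε : ℤˣ) (n : Fin (∑ j, lam j) → ℤ) : ℤ :=
  ∑ᶠ k : ℤ, ((ε ^ k : ℤˣ) : ℤ) * aperyTerm lam n k

/-! Write `T(n, k)` for the summand and `G` for `primeFactorial p`, the factorial that skips
multiples of `p`, continued to negative arguments. Splitting the factors of gamma functions
according to divisibility by `p` shows that the multinomial coefficient of `b` equals that of `⌊b /
p⌋` times the `p`-adic unit `G(∑ bᵢ) / ∏ G(bᵢ)`, provided that the floors add up
(`intMultinomial_mul_prod_primeFactorial`). The sum `A(p ^ r n)` is then split according to whether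
`p` divides the summation index.

An index `p k` is compared with the index `k` of `A(p ^ (r - 1) n)`: `T(p ^ r n, p k)` is `T(p ^ (r
- 1) n, k)` times a unit `U`. With `t = min(v_p(k), r - 1)`, absorption `k * binom(n, k) = n *
binom(n - 1, k - 1)` makes each block of `T(p ^ (r - 1) n, k)` divisible by `p ^ (r - 1 - t)`, so it
remains to see that `U` is `1` modulo `p ^ (2 (t + 1))` for (a) and modulo `p ^ (r + 2 (t + 1))` for
(b). This holds because `G` nearly turns sums into products. Pairing `j` with `q - j`, for `q = p ^
s ≠ 2`, gives `G(X + q) = G(X) H(X (X + q))` for `p ∣ X` with an integer polynomial `H`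
(`primeFactorial_add_prime_pow`), and `H(X (X + q))` barely changes when `X` is shifted by a highly
divisible number. For `p ≥ 5` it changes even less, since `H'` is divisible by `q` at multiples of
`q`, a consequence of `∑ 1 / j ^ 2 ≡ 0`. In (b), blocks of length at most two leave only `G(p k)
G(-p k)`, which is `1` by reflection. For `p = 2` and odd `k` the pairing is unavailable at `q = 2`,
and a separate analysis modulo `4` is needed.

For indices prime to `p` every block is divisible by `p ^ r`, which settles (a), and (b) for at
least three blocks. For two blocks the last factor `p ^ r` comes from cancellation: the summand is
`p ^ (2 r)` times a constant times `f_r(k - 1) ε ^ k / k ^ 2`, where `f_(i+1)(m) ≡ f_i(⌊m / p⌋)`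
modulo `p ^ (i + 1)`, while `ε ^ k / k ^ 2` sums to `0` modulo `p ^ s` over each aligned interval of
length `p ^ s`. Regrouping level by level (`pow_dvd_sum_mul_of_tower`) combines the two facts. -/

theorem Int.apply_eq_of_apply_add_one_eq {α : Type*} {f : ℤ → α} (h : ∀ n, f (n + 1) = f n)
    (m n : ℤ) : f m = f n := by
  have key : ∀ n : ℤ, f n = f 0 := by
    intro n
    induction n using Int.induction_on with
    | zero => rfl
    | succ i ih => rw [h, ih]
    | pred i ih => rw [← h, sub_add_cancel, ih]
  rw [key m, key n]

/-! ### Two-sided products and the prime-to-`p` part of the gamma function -/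

section IntProd

variable {A : Type*} [DivisionCommMonoid A]

/-- The product of `h 1, …, h n`, extended to negative `n` such that
`intProd h (n + 1) = intProd h n * h (n + 1)` whenever all values of `h` are invertible. -/
noncomputable def intProd (h : ℤ → A) (n : ℤ) : A :=
  (∏ j ∈ Finset.Ioc 0 n, h j) / ∏ j ∈ Finset.Ioc n 0, h j

@[simp] theorem intProd_zero (h : ℤ → A) : intProd h 0 = 1 := by simp [intProd]

theorem intProd_add_one {h : ℤ → A} (hh : ∀ j, IsUnit (h j)) (n : ℤ) :
    intProd h (n + 1) = intProd h n * h (n + 1) := by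
  unfold intProd
  rcases le_or_gt 0 n with hn | hn
  · have h1 : Finset.Ioc 0 (n + 1) = insert (n + 1) (Finset.Ioc 0 n) := by
      ext j; simp only [Finset.mem_insert, Finset.mem_Ioc]; omega
    rw [h1, Finset.prod_insert (by simp), Finset.Ioc_eq_empty (a := n) (by omega),
      Finset.Ioc_eq_empty (a := n + 1) (by omega)]
    simp [mul_comm]
  · have h1 : Finset.Ioc n 0 = insert (n + 1) (Finset.Ioc (n + 1) 0) := by
      ext j; simp only [Finset.mem_insert, Finset.mem_Ioc]; omega
    rw [h1, Finset.prod_insert (by simp), Finset.Ioc_eq_empty (b := n) (by omega),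
      Finset.Ioc_eq_empty (b := n + 1) (by omega), Finset.prod_empty, div_mul_eq_mul_div, one_mul,
      ← div_div, (hh _).div_self]

theorem map_intProd {B F : Type*} [DivisionCommMonoid B] [FunLike F A B] [MonoidHomClass F A B]
    (φ : F) (hφ : ∀ x y, φ (x / y) = φ x / φ y) (h : ℤ → A) (n : ℤ) :
    φ (intProd h n) = intProd (fun j => φ (h j)) n := by
  simp [intProd, hφ, map_prod]

end IntProd

/-- `x + j` if `p` does not divide `j`, and `1` otherwise. -/
def primePart {K : Type*} [Field K] (p : ℕ) (x : K) (j : ℤ) : K :=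
  if (p : ℤ) ∣ j then 1 else x + j

theorem primePart_zero_ne_zero {K : Type*} [Field K] [CharZero K] (p : ℕ) (j : ℤ) :
    primePart p (0 : K) j ≠ 0 := by
  unfold primePart
  split_ifs with h
  · exact one_ne_zero
  · rw [zero_add]
    intro h0
    exact h ((Int.cast_eq_zero.mp h0) ▸ dvd_zero _)

theorem tendsto_intProd_primePart (p : ℕ) (n : ℤ) :
    Tendsto (fun z : ℂ => intProd (primePart p ((p : ℂ) * z)) n) (𝓝[≠] 0)
      (𝓝 (intProd (primePart p (0 : ℂ)) n)) := by
  have h : ∀ j : ℤ, Tendsto (fun z : ℂ => primePart p ((p : ℂ) * z) j) (𝓝[≠] 0)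
      (𝓝 (primePart p (0 : ℂ) j)) := by
    intro j
    unfold primePart
    split_ifs
    · exact tendsto_const_nhds
    · have : Continuous fun z : ℂ => (p : ℂ) * z + j := by fun_prop
      simpa using (this.tendsto 0).mono_left (nhdsWithin_le_nhds (s := {0}ᶜ))
  unfold intProd
  refine Tendsto.div (tendsto_finsetProd _ fun j _ => h j) (tendsto_finsetProd _ fun j _ => h j) ?_
  exact Finset.prod_ne_zero_iff.mpr fun j _ => primePart_zero_ne_zero p j

theorem Int.add_one_ediv_of_dvd {p n : ℤ} (hp : 0 < p) (h : p ∣ n + 1) :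
    (n + 1) / p = n / p + 1 := by
  obtain ⟨c, hc⟩ := h
  rw [hc, Int.mul_ediv_cancel_left _ hp.ne']
  have : n = -1 + p * c := by omega
  rw [this, Int.add_mul_ediv_left _ _ hp.ne', Int.ediv_eq_neg_one_of_neg_of_le (by omega) (by omega)]
  omega

theorem Int.add_one_ediv_of_not_dvd {p n : ℤ} (hp : 0 < p) (h : ¬ p ∣ n + 1) :
    (n + 1) / p = n / p := by
  have h1 := Int.mul_ediv_add_emod n p
  have h2 := Int.emod_nonneg n hp.ne'
  have h3 := Int.emod_lt_of_pos n hp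
  have h4 : n % p + 1 ≠ p := fun h5 => h ⟨n / p + 1, by linarith⟩
  rw [Int.ediv_eq_iff_of_pos hp]
  constructor <;> nlinarith [lt_of_le_of_ne (show n % p + 1 ≤ p by omega) h4]

theorem Int.neg_one_sub_ediv {p : ℤ} (hp : 0 < p) (m : ℤ) : (-1 - m) / p = -1 - m / p := by
  have h1 := Int.mul_ediv_add_emod m p
  have h2 := Int.emod_nonneg m hp.ne'
  have h3 := Int.emod_lt_of_pos m hp
  rw [Int.ediv_eq_iff_of_pos hp]
  constructor <;> nlinarith

/-- The quotient of the two sides does not change under `n ↦ n + 1`. The new factor `p z + n + 1`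
goes into `primePart` if `p ∤ n + 1`; otherwise it equals `p` times the new factor of the gamma
function at `z + ⌊n / p⌋ + 1`. At `n = 0` both sides agree. -/
theorem Gamma_natCast_mul_add {p : ℕ} (hp : 0 < p) {z : ℂ} (hz : ∀ m : ℤ, z + m ≠ 0)
    (hpz : ∀ m : ℤ, (p : ℂ) * z + m ≠ 0) (n : ℤ) :
    Complex.Gamma (p * z + n + 1) * Complex.Gamma (z + 1) =
      Complex.Gamma (z + (n / p : ℤ) + 1) * Complex.Gamma (p * z + 1) * (p : ℂ) ^ (n / p : ℤ) *
        intProd (primePart p ((p : ℂ) * z)) n := by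
  have hp0 : (p : ℂ) ≠ 0 := by exact_mod_cast hp.ne'
  have hu : ∀ j, primePart p ((p : ℂ) * z) j ≠ 0 := by
    intro j
    unfold primePart
    split_ifs
    · exact one_ne_zero
    · exact hpz j
  have hP : ∀ n, intProd (primePart p ((p : ℂ) * z)) n ≠ 0 := by
    intro n
    unfold intProd
    exact div_ne_zero (Finset.prod_ne_zero_iff.mpr fun j _ => hu j)
      (Finset.prod_ne_zero_iff.mpr fun j _ => hu j)
  let f : ℤ → ℂ := fun n => Complex.Gamma (p * z + n + 1) /
    (Complex.Gamma (z + (n / p : ℤ) + 1) * (p : ℂ) ^ (n / p : ℤ) *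
      intProd (primePart p ((p : ℂ) * z)) n)
  have hf : ∀ n, f (n + 1) = f n := by
    intro n
    have hg := Gamma_ne_zero_of_add_int hz (n / p)
    have hg1 := Gamma_ne_zero_of_add_int hz (n / p + 1)
    have hPn := hP n
    have h1 := Complex.Gamma_add_one (p * z + n + 1) (by simpa [add_assoc] using hpz (n + 1))
    have e1 : (p * z + ((n + 1 : ℤ) : ℂ) + 1) = p * z + n + 1 + 1 := by push_cast; ring
    have hx := hpz (n + 1)
    push_cast at hx
    simp only [f]
    rw [e1, h1, intProd_add_one (fun j => (hu j).isUnit)]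
    by_cases hd : (p : ℤ) ∣ n + 1
    · have h2 := Int.add_one_ediv_of_dvd (by exact_mod_cast hp) hd
      have h3 := Complex.Gamma_add_one (z + (n / p : ℤ) + 1)
        (by simpa [add_assoc] using hz (n / p + 1))
      have e2 : (z + ((n / p + 1 : ℤ) : ℂ) + 1) = z + (n / p : ℤ) + 1 + 1 := by push_cast; ring
      have h4 : primePart p ((p : ℂ) * z) (n + 1) = 1 := if_pos hd
      have h5 : (p : ℂ) * (z + (n / p : ℤ) + 1) = p * z + n + 1 := by
        have : (n + 1 : ℤ) = p * (n / p + 1) := by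
          rw [← h2, Int.mul_ediv_cancel' hd]
        have h6 := congrArg (Int.cast : ℤ → ℂ) this
        push_cast at h6
        linear_combination -h6
      rw [e2] at hg1
      rw [h2, e2, h3, h4, zpow_add_one₀ hp0, ← h5]
      have h7 : z + ((n / p : ℤ) : ℂ) + 1 ≠ 0 := by simpa [add_assoc] using hz (n / p + 1)
      field_simp
    · have h2 := Int.add_one_ediv_of_not_dvd (by exact_mod_cast hp) hd
      have h4 : primePart p ((p : ℂ) * z) (n + 1) = p * z + n + 1 := by
        rw [primePart, if_neg hd]; push_cast; ring
      rw [h2, h4]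
      have h7 : (p : ℂ) * z + n + 1 ≠ 0 := by simpa [add_assoc] using hx
      field_simp
  have h0 := Int.apply_eq_of_apply_add_one_eq hf n 0
  have hg := Gamma_ne_zero_of_add_int hz (n / p)
  have hg0 : Complex.Gamma (z + 1) ≠ 0 := by simpa using Gamma_ne_zero_of_add_int hz 0
  have hPn := hP n
  simp only [f] at h0
  simp only [Int.cast_zero, add_zero, Int.zero_ediv, zpow_zero, mul_one, intProd_zero] at h0
  rw [div_eq_div_iff (by positivity) hg0] at h0
  rw [h0]; ring

/-! ### Multinomial identities read off from gamma quotients -/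

theorem intMultinomial_perm {b c : List ℤ} (h : b.Perm c) : intMultinomial b = intMultinomial c := by
  rcases eq_or_ne b [] with rfl | hb
  · rw [h.nil_eq]
  have hc : c ≠ [] := fun hc => hb (by simpa [hc] using h)
  have h1 := tendsto_intMultinomial b hb
  have h2 := tendsto_intMultinomial c hc
  rw [h.sum_eq] at h1
  have h3 : ∀ z : ℂ, (b.map fun c : ℤ => Complex.Gamma (z + c + 1)).prod =
      (c.map fun c : ℤ => Complex.Gamma (z + c + 1)).prod := fun z => (h.map _).prod_eq
  simp only [h3] at h1
  exact_mod_cast tendsto_nhds_unique h1 h2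

theorem intBinom_self (n : ℤ) : intBinom n n = 1 := by
  by_cases hc : 0 ≤ n
  · obtain ⟨m, rfl⟩ := Int.eq_ofNat_of_zero_le hc
    simp [intBinom, Ring.choose_natCast]
  · simp [intBinom, hc]

theorem intMultinomial_singleton (n : ℤ) : intMultinomial [n] = 1 := by
  simp [intMultinomial, intBinom_self]

theorem intMultinomial_pair (a b : ℤ) : intMultinomial [a, b] = intBinom (a + b) a := by
  rw [intMultinomial, intMultinomial_singleton]; simp

/-- Merging two entries inserts and cancels one gamma factor. Passing through the limit avoids a
case distinction on signs. -/
theorem intMultinomial_cons_cons (a b : ℤ) (L : List ℤ) :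
    intMultinomial (a :: b :: L) = intBinom (a + b) a * intMultinomial ((a + b) :: L) := by
  have h1 := tendsto_intMultinomial (a :: b :: L) (by simp)
  have h2 := (tendsto_intBinom (a + b) a).mul (tendsto_intMultinomial ((a + b) :: L) (by simp))
  have h3 := h2.congr' (f₂ := fun z : ℂ => Complex.Gamma (z + (a :: b :: L).sum + 1) /
      ((a :: b :: L).map fun c : ℤ => Complex.Gamma (z + c + 1)).prod) (by
    filter_upwards [eventually_add_int_ne_zero] with z hz
    have h4 := Gamma_ne_zero_of_add_int hz (a + b)
    simp only [List.map_cons, List.prod_cons, List.sum_cons, add_sub_cancel_left, ← add_assoc a b]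
    field_simp)
  exact_mod_cast tendsto_nhds_unique h1 h3

theorem mul_intBinom (n k : ℤ) : k * intBinom n k = n * intBinom (n - 1) (k - 1) := by
  have hz1 : ∀ c : ℤ, Tendsto (fun z : ℂ => z + c) (𝓝[≠] 0) (𝓝 (c : ℂ)) := by
    intro c
    have : Continuous fun z : ℂ => z + c := by fun_prop
    simpa using (this.tendsto 0).mono_left (nhdsWithin_le_nhds (s := {0}ᶜ))
  have h1 := (hz1 k).mul (tendsto_intBinom n k)
  have h2 := (hz1 n).mul (tendsto_intBinom (n - 1) (k - 1))
  have h3 := h2.congr' (f₂ := fun z : ℂ => (z + k) * (Complex.Gamma (z + n + 1) /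
      (Complex.Gamma (z + k + 1) * Complex.Gamma (z + (n - k : ℤ) + 1)))) (by
    filter_upwards [eventually_add_int_ne_zero] with z hz
    have e1 := Complex.Gamma_add_one (z + n) (hz n)
    have e2 := Complex.Gamma_add_one (z + k) (hz k)
    have h4 := Gamma_ne_zero_of_add_int hz (n - k)
    have h5 := Gamma_ne_zero_of_add_int hz k
    have h6 := hz k
    rw [e2] at h5
    have h7 := right_ne_zero_of_mul h5
    have e3 : z + ((n - 1 : ℤ) : ℂ) + 1 = z + n := by push_cast; ring
    have e4 : z + ((k - 1 : ℤ) : ℂ) + 1 = z + k := by push_cast; ring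
    rw [e1, e2, e3, e4, show n - 1 - (k - 1) = n - k by ring]
    field_simp)
  exact_mod_cast tendsto_nhds_unique h1 h3

theorem prod_map_Gamma_natCast_mul_add {p : ℕ} (hp : 0 < p) {z : ℂ} (hz : ∀ m : ℤ, z + m ≠ 0)
    (hpz : ∀ m : ℤ, (p : ℂ) * z + m ≠ 0) (b : List ℤ) :
    (b.map fun c : ℤ => Complex.Gamma (p * z + c + 1)).prod * Complex.Gamma (z + 1) ^ b.length =
      (b.map fun c : ℤ => Complex.Gamma (z + (c / p : ℤ) + 1)).prod *
        Complex.Gamma (p * z + 1) ^ b.length * (p : ℂ) ^ (b.map (· / (p : ℤ))).sum *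
        (b.map (intProd (primePart p ((p : ℂ) * z)))).prod := by
  have hp0 : (p : ℂ) ≠ 0 := by exact_mod_cast hp.ne'
  induction b with
  | nil => simp
  | cons c L ih =>
    simp only [List.map_cons, List.prod_cons, List.sum_cons, List.length_cons, pow_succ,
      zpow_add₀ hp0]
    have := Gamma_natCast_mul_add hp hz hpz c
    linear_combination (Complex.Gamma (p * z + c + 1) * Complex.Gamma (z + 1)) * ih +
      (List.map (fun c : ℤ ↦ Complex.Gamma (z + (c / p : ℤ) + 1)) L).prod *
        Complex.Gamma (p * z + 1) ^ L.length * (p : ℂ) ^ (L.map (· / (p : ℤ))).sum *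
        (L.map (intProd (primePart p ((p : ℂ) * z)))).prod * this

/-- Compare the defining limit at `p z` with the one for the floors at `z`. The condition on the
floors makes the powers of `p` cancel, and the leftover gamma factors tend to `1`. The outcome is an
identity of rationals, so it can be transported to `ℚ_[p]`. -/
theorem intMultinomial_mul_prod_intProd {p : ℕ} (hp : 0 < p) (b : List ℤ)
    (hb : b.sum / p = (b.map (· / (p : ℤ))).sum) :
    (intMultinomial b : ℚ) * (b.map (intProd (primePart p (0 : ℚ)))).prod =
      intMultinomial (b.map (· / (p : ℤ))) * intProd (primePart p (0 : ℚ)) b.sum := by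
  rcases eq_or_ne b [] with rfl | hne
  · simp
  have hp0 : (p : ℂ) ≠ 0 := by exact_mod_cast hp.ne'
  have hmul : Tendsto (fun z : ℂ => (p : ℂ) * z) (𝓝[≠] 0) (𝓝[≠] 0) := by
    refine tendsto_nhdsWithin_iff.mpr ⟨?_, ?_⟩
    · have : Continuous fun z : ℂ => (p : ℂ) * z := by fun_prop
      simpa using (this.tendsto 0).mono_left (nhdsWithin_le_nhds (s := {0}ᶜ))
    · filter_upwards [self_mem_nhdsWithin] with z hz
      exact mul_ne_zero hp0 hz
  have hGam : ∀ u : ℂ → ℂ, Tendsto u (𝓝[≠] 0) (𝓝[≠] 0) →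
      Tendsto (fun z : ℂ => Complex.Gamma (u z + 1)) (𝓝[≠] 0) (𝓝 1) := by
    intro u hu
    have h1 : ContinuousAt (fun z : ℂ => Complex.Gamma (z + 1)) 0 := by
      have h2 := (Complex.differentiableAt_Gamma (0 + 1) (by
        intro m hm
        have := congrArg Complex.re hm
        simp at this
        linarith [(Nat.cast_nonneg m : (0 : ℝ) ≤ m)])).continuousAt
      exact ContinuousAt.comp (g := Complex.Gamma) h2 (by fun_prop)
    have h3 : Tendsto (fun z : ℂ => Complex.Gamma (z + 1)) (𝓝 0) (𝓝 1) := by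
      simpa [ContinuousAt] using h1
    exact h3.comp (hu.mono_right nhdsWithin_le_nhds)
  have hC1 := hGam _ hmul
  have hC2 := hGam _ tendsto_id
  have hl : Tendsto (fun z : ℂ => (b.map (intProd (primePart p ((p : ℂ) * z)))).prod) (𝓝[≠] 0)
      (𝓝 (b.map (intProd (primePart p (0 : ℂ)))).prod) := by
    clear hb hne
    induction b with
    | nil => simp
    | cons c L ih => simpa using (tendsto_intProd_primePart p c).mul ih
  have h1 := (((tendsto_intMultinomial b hne).comp hmul).mul hl).mul (hC1.pow b.length |>.mul hC2)
  have h2 := ((tendsto_intMultinomial (b.map (· / (p : ℤ))) (by simpa)).mul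
    (tendsto_intProd_primePart p b.sum)).mul (hC2.pow b.length |>.mul hC1)
  have h3 := tendsto_nhds_unique h1 (h2.congr' ?_)
  · simp only [one_pow, mul_one] at h3
    have hcast : ∀ n, intProd (primePart p (0 : ℂ)) n =
        ((intProd (primePart p (0 : ℚ)) n : ℚ) : ℂ) := by
      intro n
      have := map_intProd (Rat.castHom ℂ) (fun x y => map_div₀ _ x y) (primePart p (0 : ℚ)) n
      rw [eq_ratCast] at this
      rw [this]
      congr 1
      funext j
      unfold primePart
      split_ifs <;> simp
    have hlist : (b.map (intProd (primePart p (0 : ℂ)))).prod =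
        (((b.map (intProd (primePart p (0 : ℚ)))).prod : ℚ) : ℂ) := by
      rw [Rat.cast_list_prod, List.map_map]
      congr 2
      funext n
      exact hcast n
    rw [hcast, hlist] at h3
    exact_mod_cast h3
  · filter_upwards [eventually_add_int_ne_zero, hmul.eventually eventually_add_int_ne_zero]
      with z hz hpz
    have e1 := Gamma_natCast_mul_add hp hz hpz b.sum
    have e2 := prod_map_Gamma_natCast_mul_add hp hz hpz b
    have n1 : (b.map fun c : ℤ => Complex.Gamma (p * z + c + 1)).prod ≠ 0 := by
      refine List.prod_ne_zero ?_
      rw [List.mem_map]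
      rintro ⟨c, -, hc⟩
      exact Gamma_ne_zero_of_add_int hpz c hc
    have n2 : (b.map fun c : ℤ => Complex.Gamma (z + (c / p : ℤ) + 1)).prod ≠ 0 := by
      refine List.prod_ne_zero ?_
      rw [List.mem_map]
      rintro ⟨c, -, hc⟩
      exact Gamma_ne_zero_of_add_int hz _ hc
    simp only [Function.comp_apply, id_eq, List.map_map, Function.comp_def]
    rw [hb] at e1
    generalize Complex.Gamma (p * z + 1) ^ b.length = X1 at e2 ⊢
    generalize Complex.Gamma (z + 1) ^ b.length = X2 at e2 ⊢
    generalize (b.map fun c : ℤ => Complex.Gamma (p * z + c + 1)).prod = X3 at *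
    generalize (b.map fun c : ℤ => Complex.Gamma (z + (c / p : ℤ) + 1)).prod = X4 at *
    generalize (b.map (intProd (primePart p ((p : ℂ) * z)))).prod = X5 at *
    generalize intProd (primePart p ((p : ℂ) * z)) b.sum = X6 at *
    generalize (b.map fun x => x / (p : ℤ)).sum = S at *
    rw [div_mul_eq_mul_div, div_mul_eq_mul_div, div_mul_eq_mul_div, div_mul_eq_mul_div,
      div_eq_div_iff n2 n1]
    linear_combination Complex.Gamma (z + S + 1) * X6 * Complex.Gamma (p * z + 1) * e2 -
      X5 * X1 * X4 * e1

/-! ### The prime-to-`p` factorial as a `p`-adic unit -/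

section Padic

variable (p : ℕ) [Fact p.Prime]

theorem PadicInt.isUnit_intCast_iff {p : ℕ} [Fact p.Prime] {j : ℤ} :
    IsUnit (j : ℤ_[p]) ↔ ¬ (p : ℤ) ∣ j := by
  rw [PadicInt.isUnit_iff, ← PadicInt.norm_int_lt_one_iff_dvd]
  have := PadicInt.norm_le_one (j : ℤ_[p])
  constructor
  · intro h; rw [h]; exact lt_irrefl _
  · intro h; exact le_antisymm this (not_lt.mp h)

/-- The unit `j` of `ℤ_[p]` if `p` does not divide `j`, and `1` otherwise. -/
noncomputable def primeUnit (j : ℤ) : ℤ_[p]ˣ :=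
  if h : (p : ℤ) ∣ j then 1 else (PadicInt.isUnit_intCast_iff.mpr h).unit

/-- The product of the integers in `[1, n]` that are prime to `p`, extended to negative `n`. -/
noncomputable def primeFactorial (n : ℤ) : ℤ_[p]ˣ := intProd (primeUnit p) n

variable {p}

theorem primeUnit_of_dvd {j : ℤ} (h : (p : ℤ) ∣ j) : primeUnit p j = 1 := dif_pos h

theorem coe_primeUnit (j : ℤ) : (primeUnit p j : ℤ_[p]) = if (p : ℤ) ∣ j then 1 else (j : ℤ_[p]) := by
  unfold primeUnit
  split_ifs <;> simp

@[simp] theorem primeFactorial_zero : primeFactorial p 0 = 1 := intProd_zero _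

theorem primeFactorial_add_one (n : ℤ) :
    primeFactorial p (n + 1) = primeFactorial p n * primeUnit p (n + 1) :=
  intProd_add_one (fun _ => Group.isUnit _) n

theorem coe_primeFactorial (n : ℤ) :
    ((primeFactorial p n : ℤ_[p]) : ℚ_[p]) = ((intProd (primePart p (0 : ℚ)) n : ℚ) : ℚ_[p]) := by
  have h1 := map_intProd (Rat.castHom ℚ_[p]) (fun x y => map_div₀ _ x y) (primePart p (0 : ℚ)) n
  have h2 := map_intProd ((PadicInt.Coe.ringHom (p := p)).toMonoidHom.comp (Units.coeHom ℤ_[p]))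
    (fun x y => by
      have hy : PadicInt.Coe.ringHom (p := p) (y : ℤ_[p]) ≠ 0 :=
        (y.isUnit.map (PadicInt.Coe.ringHom (p := p))).ne_zero
      change PadicInt.Coe.ringHom (p := p) ((x / y : ℤ_[p]ˣ) : ℤ_[p]) =
        PadicInt.Coe.ringHom (p := p) (x : ℤ_[p]) / PadicInt.Coe.ringHom (p := p) (y : ℤ_[p])
      rw [eq_div_iff hy, ← map_mul, ← Units.val_mul, div_mul_cancel]) (primeUnit p) n
  rw [eq_ratCast] at h1
  rw [h1]
  refine h2.trans ?_
  congr 1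
  funext j
  change ((primeUnit p j : ℤ_[p]) : ℚ_[p]) = _
  rw [coe_primeUnit]
  unfold primePart
  split_ifs <;> simp

theorem intMultinomial_mul_prod_primeFactorial (b : List ℤ)
    (hb : b.sum / p = (b.map (· / (p : ℤ))).sum) :
    (intMultinomial b : ℤ_[p]) * ((b.map (primeFactorial p)).prod : ℤ_[p]ˣ) =
      intMultinomial (b.map (· / (p : ℤ))) * (primeFactorial p b.sum : ℤ_[p]) := by
  have h := intMultinomial_mul_prod_intProd (Fact.out : p.Prime).pos b hb
  have hl : (((b.map (primeFactorial p)).prod : ℤ_[p]ˣ) : ℚ_[p]) =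
      (((b.map (intProd (primePart p (0 : ℚ)))).prod : ℚ) : ℚ_[p]) := by
    clear h hb
    induction b with
    | nil => simp
    | cons c L ih => simp [coe_primeFactorial, ih]
  have h2 := congrArg (Rat.cast : ℚ → ℚ_[p]) h
  push_cast at h2
  rw [← coe_primeFactorial] at h2
  apply PadicInt.ext
  push_cast
  rw [← h2, hl, Rat.cast_list_prod]

theorem primeFactorial_add_natCast (X : ℤ) (n : ℕ) :
    primeFactorial p (X + n) = primeFactorial p X * ∏ j ∈ Finset.range n, primeUnit p (X + j + 1) := by
  induction n with
  | zero => simp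
  | succ n ih =>
    rw [Finset.prod_range_succ, ← mul_assoc, ← ih, ← primeFactorial_add_one]
    congr 1; push_cast; ring

/-- Both end points contribute the factor `1`, so the range of the product may be shifted by one.
This makes it symmetric under `j ↦ n - j`. -/
theorem primeFactorial_add_of_dvd {X : ℤ} {n : ℕ} (hX : (p : ℤ) ∣ X) (hn : p ∣ n) :
    primeFactorial p (X + n) = primeFactorial p X * ∏ j ∈ Finset.range n, primeUnit p (X + j) := by
  rw [primeFactorial_add_natCast]
  congr 1
  have h1 := Finset.prod_range_succ (fun j : ℕ => primeUnit p (X + j)) n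
  have h2 := Finset.prod_range_succ' (fun j : ℕ => primeUnit p (X + j)) n
  have hn' : (p : ℤ) ∣ n := by exact_mod_cast hn
  rw [primeUnit_of_dvd (dvd_add hX hn'), mul_one] at h1
  rw [primeUnit_of_dvd (by simpa using hX), mul_one, h1] at h2
  rw [h2]
  refine Finset.prod_congr rfl fun j _ => ?_
  congr 1; push_cast; ring

/-! ### The pairing `j ↔ q - j` and sums of inverse squares -/

/-- The integers in `(0, q / 2)` that are prime to `p`. -/
def halfRange (p q : ℕ) : Finset ℕ := (Finset.range q).filter fun j => ¬ p ∣ j ∧ 2 * j < q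

/-- The hypothesis `h2` says that a midpoint, if there is one, is a multiple of `p` and hence
contributes nothing. Among prime powers this excludes only `q = 2`. -/
theorem prod_range_eq_prod_halfRange {M : Type*} [CommMonoid M] {p q : ℕ} (hpq : p ∣ q)
    (h2 : 2 * (q / 2) = q → p ∣ q / 2)
    (f : ℕ → M) :
    (∏ j ∈ Finset.range q, if p ∣ j then 1 else f j) = ∏ j ∈ halfRange p q, f j * f (q - j) := by
  have h3 : ∀ j, (if p ∣ j then 1 else f j) = if ¬ p ∣ j then f j else 1 := by
    intro j; split_ifs <;> simp_all
  simp only [h3]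
  rw [← Finset.prod_filter, Finset.prod_mul_distrib,
    ← Finset.prod_filter_mul_prod_filter_not _ (fun j => 2 * j < q)]
  congr 1
  · rw [halfRange, Finset.filter_filter]
  · refine Finset.prod_nbij' (fun j => q - j) (fun j => q - j) ?_ ?_ ?_ ?_ ?_
    · intro j hj
      simp only [Finset.mem_filter, Finset.mem_range, halfRange] at hj ⊢
      obtain ⟨⟨h4, h5⟩, h6⟩ := hj
      have h7 : j ≠ 0 := fun h => h5 (h ▸ dvd_zero _)
      refine ⟨by omega, fun h => h5 ((Nat.dvd_sub_iff_right h4.le hpq).mp h), ?_⟩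
      rcases (not_lt.mp h6).eq_or_lt with h8 | h8
      · exact absurd (by have := h2 (by omega); rwa [show q / 2 = j by omega] at this) h5
      · omega
    · intro j hj
      simp only [Finset.mem_filter, Finset.mem_range, halfRange] at hj ⊢
      obtain ⟨h4, h5, h6⟩ := hj
      have h7 : j ≠ 0 := fun h => h5 (h ▸ dvd_zero _)
      exact ⟨⟨by omega, fun h => h5 ((Nat.dvd_sub_iff_right h4.le hpq).mp h)⟩, by omega⟩
    · intro j hj
      simp only [Finset.mem_filter, Finset.mem_range] at hj
      omega
    · intro j hj
      simp only [Finset.mem_filter, Finset.mem_range, halfRange] at hj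
      omega
    · intro j hj
      simp only [Finset.mem_filter, Finset.mem_range] at hj
      congr 1; omega

open Polynomial in
/-- The product of `X + j (q - j)` over the integers `j` in `(0, q / 2)` that are prime to `p`. -/
noncomputable def halfPoly (p q : ℕ) : ℤ[X] :=
  ∏ j ∈ halfRange p q, (X + C ((j : ℤ) * (q - j)))

theorem dvd_prime_pow_div_two {p s : ℕ} (hp : p.Prime) (hs : 1 ≤ s) (hq : p ^ s ≠ 2) :
    2 * (p ^ s / 2) = p ^ s → p ∣ p ^ s / 2 := by
  intro h
  have h2 : 2 ∣ p ^ s := ⟨_, h.symm⟩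
  have hp2 : p = 2 := ((Nat.prime_dvd_prime_iff_eq Nat.prime_two hp).mp
    (Nat.prime_two.dvd_of_dvd_pow h2)).symm
  subst hp2
  obtain ⟨t, rfl⟩ : ∃ t, s = t + 2 := ⟨s - 2, by
    have : s ≠ 1 := by rintro rfl; simp at hq
    omega⟩
  rw [pow_add]
  omega

/-- The point is `(X + j) (X + q - j) = X (X + q) + j (q - j)`: the increment of the factorial
depends on `X` only through `X (X + q)`. -/
theorem primeFactorial_add_prime_pow {s : ℕ} (hs : 1 ≤ s) (hq : p ^ s ≠ 2) {X : ℤ}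
    (hX : (p : ℤ) ∣ X) :
    (primeFactorial p (X + (p ^ s : ℕ)) : ℤ_[p]) = primeFactorial p X *
      (((halfPoly p (p ^ s)).eval (X * (X + (p ^ s : ℕ))) : ℤ) : ℤ_[p]) := by
  have hpq : p ∣ p ^ s := dvd_pow_self p (by omega)
  rw [primeFactorial_add_of_dvd hX hpq, Units.val_mul, Units.coe_prod]
  congr 1
  have h1 : ∀ j : ℕ, (primeUnit p (X + j) : ℤ_[p]) =
      if p ∣ j then 1 else ((X + j : ℤ) : ℤ_[p]) := by
    intro j
    rw [coe_primeUnit]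
    simp only [Int.dvd_add_right hX, Int.natCast_dvd_natCast]
  simp only [h1]
  rw [prod_range_eq_prod_halfRange hpq (dvd_prime_pow_div_two Fact.out hs hq), halfPoly,
    Polynomial.eval_prod, Int.cast_prod]
  refine Finset.prod_congr rfl fun j hj => ?_
  simp only [halfRange, Finset.mem_filter, Finset.mem_range] at hj
  rw [← Int.cast_mul]
  congr 1
  simp only [Polynomial.eval_add, Polynomial.eval_X, Polynomial.eval_C]
  push_cast [Nat.cast_sub hj.1.le]
  ring

/-- Substituting `2 x` for `x` shows that four times the sum equals the sum, and `3` is a unit.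
Non-units drop out because `Ring.inverse` sends them to `0`. -/
theorem sum_ringInverse_sq_zmod_eq_zero (hp5 : 5 ≤ p) (s : ℕ) :
    ∑ x : ZMod (p ^ s), Ring.inverse x ^ 2 = 0 := by
  have hp : p.Prime := Fact.out
  have hu : ∀ m : ℕ, m.Prime → m < p → IsUnit (m : ZMod (p ^ s)) := fun m hm hlt =>
    (ZMod.isUnit_iff_coprime m (p ^ s)).mpr
      (((Nat.coprime_primes hm hp).mpr hlt.ne).pow_right s)
  have h2 : IsUnit (2 : ZMod (p ^ s)) := by exact_mod_cast hu 2 Nat.prime_two (by omega)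
  have h3 : IsUnit (3 : ZMod (p ^ s)) := by exact_mod_cast hu 3 Nat.prime_three (by omega)
  have h4 : ∑ x : ZMod (p ^ s), Ring.inverse x ^ 2 =
      ∑ x : ZMod (p ^ s), Ring.inverse (2 * x) ^ 2 :=
    (Fintype.sum_equiv h2.unit.mulLeft _ _ fun x => by simp).symm
  have h5 : 4 * ∑ x : ZMod (p ^ s), Ring.inverse x ^ 2 = ∑ x : ZMod (p ^ s), Ring.inverse x ^ 2 := by
    conv_lhs => rw [h4]
    rw [Finset.mul_sum]
    refine Finset.sum_congr rfl fun x _ => ?_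
    rw [Ring.mul_inverse_rev]
    have h6 := Ring.mul_inverse_cancel _ h2
    linear_combination (Ring.inverse x ^ 2 * (2 * Ring.inverse 2 + 1)) * h6
  refine (h3.mul_right_eq_zero).mp ?_
  linear_combination h5

theorem sum_range_natCast_zmod {M : Type*} [AddCommMonoid M] (q : ℕ) [NeZero q] (f : ZMod q → M) :
    ∑ j ∈ Finset.range q, f j = ∑ x, f x := by
  refine Finset.sum_nbij' (fun j => (j : ZMod q)) ZMod.val ?_ ?_ ?_ ?_ ?_
  · simp
  · intro x _; simpa using ZMod.val_lt x
  · intro j hj; exact ZMod.val_cast_of_lt (by simpa using hj)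
  · intro x _; simp
  · simp

theorem ringInverse_natCast_of_dvd {s j : ℕ} (hs : 1 ≤ s) (h : p ∣ j) :
    Ring.inverse (j : ZMod (p ^ s)) = 0 := by
  refine Ring.inverse_non_unit _ fun hu => ?_
  rw [ZMod.isUnit_iff_coprime] at hu
  have := Nat.Coprime.coprime_dvd_right (dvd_pow_self p (by omega)) hu
  exact (Fact.out : p.Prime).one_lt.ne' (Nat.Coprime.eq_one_of_dvd this.symm h)

theorem isUnit_natCast_zmod {s j : ℕ} (h : ¬ p ∣ j) : IsUnit (j : ZMod (p ^ s)) := by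
  rw [ZMod.isUnit_iff_coprime]
  exact (((Fact.out : p.Prime).coprime_iff_not_dvd.mpr h).pow_left s).symm

theorem ringInverse_neg_sq {R : Type*} [CommRing R] (x : R) :
    Ring.inverse (-x) ^ 2 = Ring.inverse x ^ 2 := by
  by_cases h : IsUnit x
  · have h1 := Ring.mul_inverse_cancel _ h
    have h2 := Ring.mul_inverse_cancel _ h.neg
    linear_combination (Ring.inverse (-x) ^ 2 * (-x * Ring.inverse x - 1) * h1 -
      Ring.inverse x ^ 2 * (x * Ring.inverse (-x) - 1) * h2)
  · rw [Ring.inverse_non_unit _ h, Ring.inverse_non_unit _ (fun h' => h (by simpa using h'.neg))]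

theorem prime_pow_ne_two_of_five_le {p : ℕ} (hp5 : 5 ≤ p) {s : ℕ} (hs : 1 ≤ s) : p ^ s ≠ 2 := by
  have := Nat.pow_le_pow_right (by omega : 0 < p) hs
  rw [pow_one] at this
  omega

theorem sum_halfRange_ringInverse_sq (hp5 : 5 ≤ p) {s : ℕ} (hs : 1 ≤ s) :
    ∑ j ∈ halfRange p (p ^ s), Ring.inverse (j : ZMod (p ^ s)) ^ 2 = 0 := by
  have hp : p.Prime := Fact.out
  have h1 := prod_range_eq_prod_halfRange (dvd_pow_self p (by omega : s ≠ 0))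
    (dvd_prime_pow_div_two hp hs (prime_pow_ne_two_of_five_le hp5 hs))
    (fun j => Multiplicative.ofAdd (Ring.inverse (j : ZMod (p ^ s)) ^ 2))
  have h2 : ∑ j ∈ Finset.range (p ^ s), Ring.inverse (j : ZMod (p ^ s)) ^ 2 =
      ∑ j ∈ halfRange p (p ^ s), 2 * Ring.inverse (j : ZMod (p ^ s)) ^ 2 := by
    have h3 := congrArg Multiplicative.toAdd h1
    rw [toAdd_prod, toAdd_prod] at h3
    refine Eq.trans (Finset.sum_congr rfl fun j _ => ?_) (h3.trans (Finset.sum_congr rfl fun j hj => ?_))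
    · split_ifs with h
      · rw [ringInverse_natCast_of_dvd hs h]; simp
      · simp
    · simp only [halfRange, Finset.mem_filter, Finset.mem_range] at hj
      rw [toAdd_mul, toAdd_ofAdd, toAdd_ofAdd, Nat.cast_sub hj.1.le, ZMod.natCast_self, zero_sub,
        ringInverse_neg_sq]
      ring
  rw [sum_range_natCast_zmod (p ^ s) (fun x => Ring.inverse x ^ 2),
    sum_ringInverse_sq_zmod_eq_zero hp5, ← Finset.mul_sum] at h2
  have hu : IsUnit (2 : ZMod (p ^ s)) := by
    exact_mod_cast isUnit_natCast_zmod (p := p) (s := s) (j := 2)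
      (fun h => by have := Nat.le_of_dvd (by norm_num) h; omega)
  exact (hu.mul_right_eq_zero).mp h2.symm

/-- Modulo `q = p ^ s` the roots `-j (q - j)` become `j ^ 2`, so the logarithmic derivative at `0`
is minus the sum of `1 / j ^ 2` over half of the residues, which vanishes. -/
theorem prime_pow_dvd_derivative_halfPoly (hp5 : 5 ≤ p) {s : ℕ} (hs : 1 ≤ s) {t : ℤ}
    (ht : (p : ℤ) ^ s ∣ t) : (p : ℤ) ^ s ∣ (halfPoly p (p ^ s)).derivative.eval t := by
  have h0 : (p : ℤ) ^ s ∣ (halfPoly p (p ^ s)).derivative.eval 0 := by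
    have h1 : ((p ^ s : ℕ) : ℤ) ∣ (halfPoly p (p ^ s)).derivative.eval 0 := by
      rw [← ZMod.intCast_zmod_eq_zero_iff_dvd, halfPoly, Polynomial.derivative_prod_finset,
        Polynomial.eval_finsetSum]
      have h2 : ∀ j : ℕ, (((j : ℤ) * ((p ^ s : ℕ) - j) : ℤ) : ZMod (p ^ s)) = -(j : ZMod (p ^ s)) ^ 2 := by
        intro j
        rw [Int.cast_mul, Int.cast_sub, Int.cast_natCast, Int.cast_natCast, ZMod.natCast_self]
        ring
      simp only [Polynomial.eval_prod, Polynomial.eval_add, Polynomial.eval_X,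
        Polynomial.eval_C, zero_add, Polynomial.derivative_add, Polynomial.derivative_X,
        Polynomial.derivative_C, add_zero, mul_one, Int.cast_sum,
        Int.cast_prod, h2]
      calc _ = ∑ j ∈ halfRange p (p ^ s), (∏ i ∈ halfRange p (p ^ s), -(i : ZMod (p ^ s)) ^ 2) *
            -Ring.inverse (j : ZMod (p ^ s)) ^ 2 := by
            refine Finset.sum_congr rfl fun j hj => ?_
            rw [← Finset.mul_prod_erase _ _ hj]
            simp only [halfRange, Finset.mem_filter] at hj
            have h3 := Ring.mul_inverse_cancel _ (isUnit_natCast_zmod (s := s) hj.2.1)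
            linear_combination -(∏ i ∈ (halfRange p (p ^ s)).erase j, -(i : ZMod (p ^ s)) ^ 2) *
              ((j : ZMod (p ^ s)) * Ring.inverse (j : ZMod (p ^ s)) + 1) * h3
        _ = 0 := by
            rw [← Finset.mul_sum, Finset.sum_neg_distrib, sum_halfRange_ringInverse_sq hp5 hs]
            simp
    exact_mod_cast h1
  have h1 := Polynomial.sub_dvd_eval_sub t 0 (halfPoly p (p ^ s)).derivative
  rw [sub_zero] at h1
  exact (dvd_iff_dvd_of_dvd_sub (ht.trans h1)).mpr h0

theorem prime_pow_dvd_halfPoly_sub {p s r : ℕ} (hsr : s ≤ r) {X x : ℤ} (hX : (p : ℤ) ^ s ∣ X)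
    (hx : (p : ℤ) ^ r ∣ x) :
    (p : ℤ) ^ (r + s) ∣ (halfPoly p (p ^ s)).eval ((X + x) * (X + x + (p ^ s : ℕ))) -
      (halfPoly p (p ^ s)).eval (X * (X + (p ^ s : ℕ))) := by
  refine Dvd.dvd.trans ?_ (Polynomial.sub_dvd_eval_sub _ _ _)
  have : (X + x) * (X + x + (p ^ s : ℕ)) - X * (X + (p ^ s : ℕ)) =
      x * (X + X + x + (p : ℤ) ^ s) := by push_cast; ring
  rw [this, pow_add]
  exact mul_dvd_mul hx (dvd_add (dvd_add (dvd_add hX hX) ((pow_dvd_pow _ hsr).trans hx)) dvd_rfl)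

/-- Taylor expansion: the arguments differ by `d`, a multiple of `p ^ (r + s)`. The linear term
gains `p ^ s` from the derivative, and the remainder is a multiple of `d ^ 2`. -/
theorem prime_pow_dvd_halfPoly_sub_of_five_le (hp5 : 5 ≤ p) {s r : ℕ} (hs : 1 ≤ s) (hsr : s ≤ r)
    {X x : ℤ} (hX : (p : ℤ) ^ s ∣ X) (hx : (p : ℤ) ^ r ∣ x) :
    (p : ℤ) ^ (r + 2 * s) ∣ (halfPoly p (p ^ s)).eval ((X + x) * (X + x + (p ^ s : ℕ))) -
      (halfPoly p (p ^ s)).eval (X * (X + (p ^ s : ℕ))) := by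
  set t := X * (X + (p ^ s : ℕ)) with ht
  set d := x * (X + X + x + (p : ℤ) ^ s) with hd
  have h1 : (X + x) * (X + x + (p ^ s : ℕ)) = t + d := by rw [ht, hd]; push_cast; ring
  have h2 : (p : ℤ) ^ (r + s) ∣ d := by
    rw [hd, pow_add]
    exact mul_dvd_mul hx (dvd_add (dvd_add (dvd_add hX hX) ((pow_dvd_pow _ hsr).trans hx)) dvd_rfl)
  have h3 : (p : ℤ) ^ s ∣ t := by rw [ht]; exact hX.mul_right _
  obtain ⟨c, hc⟩ := Polynomial.binomExpansion (halfPoly p (p ^ s)) t d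
  rw [h1, hc]
  have h4 := mul_dvd_mul (prime_pow_dvd_derivative_halfPoly hp5 hs h3) h2
  have h5 := mul_dvd_mul h2 h2
  rw [← pow_add] at h4 h5
  have h6 : ∀ a b e : ℤ, a + b * d + e * d ^ 2 - a = b * d + e * (d * d) := by intros; ring
  rw [h6]
  refine dvd_add ((pow_dvd_pow _ (by omega)).trans h4)
    (((pow_dvd_pow _ (by omega)).trans h5).mul_left _)

/-! ### Approximate multiplicativity and reflection of the prime-to-`p` factorial -/

/-- The residue of `primeFactorial p n` modulo `p ^ e`. -/
noncomputable def primeFactorialMod (p : ℕ) [Fact p.Prime] (e : ℕ) (n : ℤ) : (ZMod (p ^ e))ˣ :=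
  Units.map (PadicInt.toZModPow e : ℤ_[p] →+* ZMod (p ^ e)).toMonoidHom (primeFactorial p n)

@[simp] theorem primeFactorialMod_zero (e : ℕ) : primeFactorialMod p e 0 = 1 := by
  simp [primeFactorialMod]

theorem coe_primeFactorialMod (e : ℕ) (n : ℤ) : (primeFactorialMod p e n : ZMod (p ^ e)) =
    PadicInt.toZModPow e (primeFactorial p n : ℤ_[p]) := rfl

/-- The quotient of the values at `x + y` and `y` is unchanged under `y ↦ y + p ^ s`, because both
values pick up the same value of `halfPoly`. At `y = 0` it is the value at `x`. -/
theorem primeFactorialMod_add_of_halfPoly {s e : ℕ} (hs : 1 ≤ s) (hq : p ^ s ≠ 2) {x : ℤ}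
    (hx : (p : ℤ) ^ s ∣ x)
    (h : ∀ X : ℤ, (p : ℤ) ^ s ∣ X →
      (p : ℤ) ^ e ∣ (halfPoly p (p ^ s)).eval ((X + x) * (X + x + (p ^ s : ℕ))) -
        (halfPoly p (p ^ s)).eval (X * (X + (p ^ s : ℕ)))) {y : ℤ} (hy : (p : ℤ) ^ s ∣ y) :
    primeFactorialMod p e (x + y) = primeFactorialMod p e x * primeFactorialMod p e y := by
  obtain ⟨b, rfl⟩ := hy
  have hps : (p : ℤ) ∣ (p : ℤ) ^ s := dvd_pow_self _ (by omega)
  have key := Int.apply_eq_of_apply_add_one_eq (f := fun b : ℤ =>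
    primeFactorialMod p e (x + (p : ℤ) ^ s * b) * (primeFactorialMod p e ((p : ℤ) ^ s * b))⁻¹) ?_ b 0
  · simp only [mul_zero, add_zero, primeFactorialMod_zero, inv_one, mul_one] at key
    rw [← key, inv_mul_cancel_right]
  · intro b
    have step : ∀ X : ℤ, (p : ℤ) ∣ X → (primeFactorialMod p e (X + (p : ℤ) ^ s) : ZMod (p ^ e)) =
        primeFactorialMod p e X * (((halfPoly p (p ^ s)).eval (X * (X + (p ^ s : ℕ))) : ℤ) :
          ZMod (p ^ e)) := by
      intro X hX
      have := congrArg (PadicInt.toZModPow e) (primeFactorial_add_prime_pow hs hq hX)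
      rw [map_mul, map_intCast] at this
      rw [coe_primeFactorialMod, coe_primeFactorialMod, ← this]
      push_cast; rfl
    have hX : (p : ℤ) ^ s ∣ (p : ℤ) ^ s * b := dvd_mul_right _ _
    have h1 := step _ (hps.trans hX)
    have h2 := step _ (hps.trans (dvd_add hx hX))
    have h3 : (((halfPoly p (p ^ s)).eval ((x + (p : ℤ) ^ s * b) *
        (x + (p : ℤ) ^ s * b + (p ^ s : ℕ))) : ℤ) : ZMod (p ^ e)) =
        (((halfPoly p (p ^ s)).eval ((p : ℤ) ^ s * b * ((p : ℤ) ^ s * b + (p ^ s : ℕ))) : ℤ) :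
          ZMod (p ^ e)) := by
      have h4 := h _ hX
      rw [eq_comm, ZMod.intCast_eq_intCast_iff_dvd_sub]
      rw [add_comm ((p : ℤ) ^ s * b) x] at h4
      exact_mod_cast h4
    rw [h3] at h2
    rw [mul_inv_eq_iff_eq_mul, mul_right_comm, eq_mul_inv_iff_mul_eq]
    apply Units.ext
    have e1 : (p : ℤ) ^ s * (b + 1) = (p : ℤ) ^ s * b + (p : ℤ) ^ s := by ring
    rw [Units.val_mul, Units.val_mul, e1, ← add_assoc, h1, h2]
    ring

theorem primeFactorialMod_add {s r : ℕ} (hs : 1 ≤ s) (hsr : s ≤ r) (hq : p ^ s ≠ 2) {x y : ℤ}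
    (hx : (p : ℤ) ^ r ∣ x) (hy : (p : ℤ) ^ s ∣ y) :
    primeFactorialMod p (r + s) (x + y) =
      primeFactorialMod p (r + s) x * primeFactorialMod p (r + s) y :=
  primeFactorialMod_add_of_halfPoly hs hq ((pow_dvd_pow _ hsr).trans hx)
    (fun _ hX => prime_pow_dvd_halfPoly_sub hsr hX hx) hy

theorem primeFactorialMod_add_of_five_le (hp5 : 5 ≤ p) {s r : ℕ} (hs : 1 ≤ s) (hsr : s ≤ r)
    {x y : ℤ} (hx : (p : ℤ) ^ r ∣ x) (hy : (p : ℤ) ^ s ∣ y) :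
    primeFactorialMod p (r + 2 * s) (x + y) =
      primeFactorialMod p (r + 2 * s) x * primeFactorialMod p (r + 2 * s) y :=
  primeFactorialMod_add_of_halfPoly hs
    (prime_pow_ne_two_of_five_le hp5 hs)
    ((pow_dvd_pow _ hsr).trans hx)
    (fun _ hX => prime_pow_dvd_halfPoly_sub_of_five_le hp5 hs hsr hX hx) hy

theorem toZModPow_primeUnit_add {e : ℕ} {x : ℤ} (he : 1 ≤ e) (hx : (p : ℤ) ^ e ∣ x) (y : ℤ) :
    PadicInt.toZModPow e (primeUnit p (x + y) : ℤ_[p]) =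
      PadicInt.toZModPow e (primeUnit p y : ℤ_[p]) := by
  have hpx : (p : ℤ) ∣ x := (dvd_pow_self _ (by omega)).trans hx
  rw [coe_primeUnit, coe_primeUnit]
  simp only [Int.dvd_add_right hpx]
  split_ifs
  · rfl
  · have h : ((x : ℤ) : ZMod (p ^ e)) = 0 := by
      rw [ZMod.intCast_zmod_eq_zero_iff_dvd]; exact_mod_cast hx
    rw [map_intCast, map_intCast, Int.cast_add, h, zero_add]

/-- Here `y` is arbitrary: shifting by a multiple of the modulus changes neither the residues of the
factors nor which of them are skipped. -/
theorem primeFactorialMod_add_right {e : ℕ} {x : ℤ} (he : 1 ≤ e) (hx : (p : ℤ) ^ e ∣ x) (y : ℤ) :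
    primeFactorialMod p e (x + y) = primeFactorialMod p e x * primeFactorialMod p e y := by
  have key := Int.apply_eq_of_apply_add_one_eq (f := fun b : ℤ =>
    primeFactorialMod p e (x + b) * (primeFactorialMod p e b)⁻¹) ?_ y 0
  · simp only [add_zero, primeFactorialMod_zero, inv_one, mul_one] at key
    rw [← key, inv_mul_cancel_right]
  · intro b
    rw [mul_inv_eq_iff_eq_mul, mul_right_comm, eq_mul_inv_iff_mul_eq]
    apply Units.ext
    simp only [Units.val_mul, coe_primeFactorialMod]
    rw [← add_assoc, primeFactorial_add_one, primeFactorial_add_one, add_assoc x, Units.val_mul,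
      Units.val_mul, map_mul, map_mul, toZModPow_primeUnit_add he hx]
    ring

/-- An analogue of the reflection formula. A step in `m` multiplies the product by `m + 1` and
divides it by `-(m + 1)`, or leaves it alone, so only the sign can change. -/
theorem primeFactorial_mul_neg_one_sub_sq (m : ℤ) :
    (primeFactorial p m * primeFactorial p (-1 - m)) ^ 2 = 1 := by
  have h0 : primeFactorial p (-1) = 1 := by
    have := primeFactorial_add_one (p := p) (-1)
    rwa [neg_add_cancel, primeFactorial_zero, primeUnit_of_dvd (dvd_zero _), mul_one, eq_comm] at this
  have key := Int.apply_eq_of_apply_add_one_eq (f := fun m : ℤ =>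
    (primeFactorial p m * primeFactorial p (-1 - m)) ^ 2) ?_ m 0
  · simpa [h0] using key
  · intro m
    have h1 := primeFactorial_add_one (p := p) m
    have h2 := primeFactorial_add_one (p := p) (-1 - (m + 1))
    have h3 : primeUnit p (m + 1) ^ 2 = primeUnit p (-1 - (m + 1) + 1) ^ 2 := by
      apply Units.ext
      rw [Units.val_pow_eq_pow_val, Units.val_pow_eq_pow_val, coe_primeUnit, coe_primeUnit,
        show -1 - (m + 1) + 1 = -(m + 1) by ring]
      simp only [Int.dvd_neg]
      split_ifs
      · rfl
      · push_cast; ring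
    rw [show -1 - m = -1 - (m + 1) + 1 by ring, h1, h2, mul_pow, mul_pow, mul_pow, mul_pow, h3]
    exact mul_right_comm _ _ _ |>.trans (mul_assoc _ _ _)

theorem primeFactorial_mul_neg_sq {y : ℤ} (hy : (p : ℤ) ∣ y) :
    (primeFactorial p y * primeFactorial p (-y)) ^ 2 = 1 := by
  have h := primeFactorial_add_one (p := p) (-1 - y)
  rw [show -1 - y + 1 = -y by ring, primeUnit_of_dvd (hy.neg_right), mul_one] at h
  rw [h, primeFactorial_mul_neg_one_sub_sq]

/-- The product is a square root of `1`, and it is `1` modulo `p`; for `p ≥ 3` this rules out `-1`.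
-/
theorem primeFactorial_mul_neg (hp3 : 3 ≤ p) {y : ℤ} (hy : (p : ℤ) ∣ y) :
    primeFactorial p y * primeFactorial p (-y) = 1 := by
  have h1 := primeFactorial_mul_neg_sq hy
  have h2 := primeFactorialMod_add_right (p := p) (e := 1) le_rfl (x := y) (by simpa using hy) (-y)
  rw [add_neg_cancel, primeFactorialMod_zero] at h2
  apply Units.ext
  have h3 := congrArg Units.val h1
  rw [Units.val_pow_eq_pow_val, Units.val_one, sq, mul_self_eq_one_iff] at h3
  refine h3.resolve_right fun h4 => ?_
  have h5 := congrArg Units.val h2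
  rw [Units.val_mul, coe_primeFactorialMod, coe_primeFactorialMod, ← map_mul, ← Units.val_mul, h4,
    map_neg, map_one, Units.val_one] at h5
  have h6 : ((2 : ℕ) : ZMod (p ^ 1)) = 0 := by push_cast; linear_combination h5
  rw [ZMod.natCast_eq_zero_iff, pow_one] at h6
  have := Nat.le_of_dvd (by norm_num) h6
  omega

end Padic

/-! ### Blocks, and when the sum is finite -/

/-- The factor of `aperyTerm` that belongs to one block `v`. -/
def blockTerm {m : ℕ} (v : Fin m → ℤ) (k : ℤ) : ℤ :=
  intMultinomial (List.ofFn (fun i => v i - k) ++ [k])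

theorem aperyTerm_eq_prod_blockTerm {l : ℕ} (lam : Fin l → ℕ) (n : Fin (∑ j, lam j) → ℤ) (k : ℤ) :
    aperyTerm lam n k = ∏ j, blockTerm (fun i => n (finSigmaFinEquiv ⟨j, i⟩)) k := rfl

/-- The entries `k` and `v 0 - k` merge into `v 0`, which isolates an ordinary binomial coefficient.
Vanishing and divisibility are both read off from it. -/
theorem blockTerm_succ {m : ℕ} (v : Fin (m + 1) → ℤ) (k : ℤ) :
    blockTerm v k = intBinom (v 0) k *
      intMultinomial (v 0 :: List.ofFn fun i : Fin m => v i.succ - k) := by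
  have h : (List.ofFn (fun i => v i - k) ++ [k]).Perm
      (k :: (v 0 - k) :: List.ofFn fun i : Fin m => v i.succ - k) := by
    rw [List.ofFn_succ]
    exact List.perm_append_comm
  rw [blockTerm, intMultinomial_perm h, intMultinomial_cons_cons, add_sub_cancel]

theorem blockTerm_one (v : Fin 1 → ℤ) (k : ℤ) : blockTerm v k = intBinom (v 0) k := by
  rw [blockTerm_succ, List.ofFn_zero, intMultinomial_singleton, mul_one]

theorem intBinom_eq_zero_of_neg {n k : ℤ} (hn : 0 ≤ n) (hk : k < 0) : intBinom n k = 0 := by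
  obtain ⟨m, rfl⟩ := Int.eq_ofNat_of_zero_le hn
  rw [intBinom, if_neg (by omega), if_pos (by omega), Ring.choose_natCast,
    Nat.choose_eq_zero_of_lt (by omega)]
  rfl

theorem intBinom_eq_zero_of_lt {n k : ℤ} (hn : 0 ≤ n) (hk : n < k) : intBinom n k = 0 := by
  obtain ⟨m, rfl⟩ := Int.eq_ofNat_of_zero_le hn
  rw [intBinom, if_pos (by omega), Ring.choose_natCast, Nat.choose_eq_zero_of_lt (by omega)]
  rfl

theorem intBinom_eq_zero_of_neg_of_lt {n k : ℤ} (hk : k < 0) (hn : n < k) : intBinom n k = 0 := by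
  rw [intBinom, if_neg (by omega), if_neg (by omega)]

theorem intBinom_eq_zero_of_lt_abs {n k : ℤ} (hn : 0 ≤ n) (hk : |n| < |k|) : intBinom n k = 0 := by
  rw [abs_of_nonneg hn] at hk
  rcases le_or_gt 0 k with h | h
  · rw [abs_of_nonneg h] at hk
    exact intBinom_eq_zero_of_lt hn hk
  · exact intBinom_eq_zero_of_neg hn h

theorem blockTerm_eq_zero_of_nonneg {m : ℕ} {v : Fin (m + 1) → ℤ} {k : ℤ} (hv : 0 ≤ v 0)
    (hk : |v 0| < |k|) : blockTerm v k = 0 := by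
  rw [blockTerm_succ, intBinom_eq_zero_of_lt_abs hv hk, zero_mul]

theorem blockTerm_eq_zero_of_two_le {m : ℕ} {v : Fin (m + 2) → ℤ} {k : ℤ}
    (hk : |v 0| + |v 1| < |k|) : blockTerm v k = 0 := by
  have h0 := abs_nonneg (v 0)
  have h1 := abs_nonneg (v 1)
  rcases le_or_gt 0 (v 0) with h | h
  · exact blockTerm_eq_zero_of_nonneg h (by omega)
  -- For `v 0 < 0` the binomial with upper entry `v 0 + v 1 - k` and lower entry `v 0` vanishes: for
  -- large positive `k` the upper entry lies below the lower one, for large negative `k` it is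
  -- nonnegative.
  rw [blockTerm_succ, List.ofFn_succ, intMultinomial_cons_cons]
  rcases le_or_gt 0 k with h2 | h2
  · rw [abs_of_nonneg h2] at hk
    have := le_abs_self (v 1)
    rw [intBinom_eq_zero_of_neg_of_lt (n := v 0 + _) h (by simp only [Fin.succ_zero_eq_one]; omega)]
    simp
  · rw [abs_of_neg h2, abs_of_neg h] at hk
    have := neg_abs_le (v 1)
    rw [intBinom_eq_zero_of_neg (n := v 0 + _) (by simp only [Fin.succ_zero_eq_one]; omega) h]
    simp

theorem blockTerm_one_ne_zero {v : Fin 1 → ℤ} {k : ℤ} (hv : v 0 < 0) (hk : 0 ≤ k) :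
    blockTerm v k ≠ 0 := by
  obtain ⟨m, rfl⟩ := Int.eq_ofNat_of_zero_le hk
  rw [blockTerm_one, intBinom, if_pos (by omega), Int.toNat_natCast]
  intro h0
  have h := Ring.descPochhammer_eq_factorial_smul_choose (v 0) m
  rw [← Polynomial.eval_eq_smeval, descPochhammer_eval_eq_prod_range, h0, smul_zero,
    Finset.prod_eq_zero_iff] at h
  obtain ⟨i, -, hi⟩ := h
  omega

/-- A block with two or more entries, or with no negative entry, vanishes for large `|k|`. If there
is no such block, each block is a binomial with negative upper entry, nonzero for all `k ≥ 0`. The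
criterion is visibly stable under scaling by `c ≥ 0`. -/
theorem aperyFinite_iff {l : ℕ} {lam : Fin l → ℕ} (hlam : ∀ j, 0 < lam j)
    {n : Fin (∑ j, lam j) → ℤ} :
    AperyFinite lam n ↔ ∃ j, 2 ≤ lam j ∨ ∀ i, 0 ≤ n (finSigmaFinEquiv ⟨j, i⟩) := by
  constructor
  · intro h
    by_contra! hcon
    refine Set.infinite_of_injective_forall_mem (f := fun k : ℕ => (k : ℤ)) Nat.cast_injective
      (fun k => ?_) h
    rw [Set.mem_ofPred_eq, aperyTerm_eq_prod_blockTerm]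
    refine Finset.prod_ne_zero_iff.mpr fun j _ => ?_
    have h1 := hlam j
    obtain ⟨h2, i, hi⟩ := hcon j
    have h3 : lam j = 1 := by omega
    generalize hv : (fun i => n (finSigmaFinEquiv ⟨j, i⟩)) = v
    have hvi : v i < 0 := by rw [← hv]; exact hi
    clear hv hi
    revert v i
    rw [h3]
    intro i v hvi
    rw [Subsingleton.elim i 0] at hvi
    exact blockTerm_one_ne_zero hvi (by positivity)
  · rintro ⟨j, hj⟩
    have key : ∃ K : ℤ, ∀ k, K < |k| → blockTerm (fun i => n (finSigmaFinEquiv ⟨j, i⟩)) k = 0 := by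
      have h1 := hlam j
      generalize hv : (fun i => n (finSigmaFinEquiv ⟨j, i⟩)) = v
      replace hj : 2 ≤ lam j ∨ ∀ i, 0 ≤ v i := by rw [← hv]; exact hj
      clear hv
      revert v
      generalize lam j = m at h1
      intro v hj
      obtain ⟨m, rfl⟩ : ∃ m', m = m' + 1 := ⟨m - 1, by omega⟩
      rcases hj with hj | hj
      · obtain ⟨m, rfl⟩ : ∃ m', m = m' + 1 := ⟨m - 1, by omega⟩
        exact ⟨|v 0| + |v 1|, fun k hk => blockTerm_eq_zero_of_two_le hk⟩
      · exact ⟨|v 0|, fun k hk => blockTerm_eq_zero_of_nonneg (hj 0) hk⟩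
    obtain ⟨K, hK⟩ := key
    refine (Set.finite_Icc (-K) K).subset fun k hk => ?_
    by_contra hk'
    refine hk (Finset.prod_eq_zero (Finset.mem_univ j) (hK k ?_))
    rw [Set.mem_Icc, ← abs_le] at hk'
    exact not_le.mp hk'

theorem AperyFinite.smul {l : ℕ} {lam : Fin l → ℕ} (hlam : ∀ j, 0 < lam j)
    {n : Fin (∑ j, lam j) → ℤ} (h : AperyFinite lam n) {c : ℤ} (hc : 0 ≤ c) :
    AperyFinite lam (c • n) := by
  rw [aperyFinite_iff hlam] at h ⊢
  obtain ⟨j, hj⟩ := h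
  exact ⟨j, hj.imp id fun hj i => mul_nonneg hc (hj i)⟩

/-! ### Divisibility of the terms by powers of `p` -/

theorem Prime.pow_sub_dvd_of_pow_dvd_mul {R : Type*} [CommRing R] [IsDomain R] {p : R}
    (hp : Prime p) {r t : ℕ} {a b : R} (ha : ¬ p ^ (t + 1) ∣ a) (h : p ^ r ∣ a * b) :
    p ^ (r - t) ∣ b := by
  induction t generalizing r a with
  | zero =>
    rw [zero_add, pow_one] at ha
    exact hp.pow_dvd_of_dvd_mul_left r ha h
  | succ t ih =>
    by_cases hpa : p ∣ a
    · obtain ⟨c, rfl⟩ := hpa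
      cases r with
      | zero => simp
      | succ r =>
        rw [Nat.add_sub_add_right]
        refine ih (fun hc => ha ?_) ((mul_dvd_mul_iff_left hp.ne_zero).mp ?_ : p ^ r ∣ c * b)
        · rw [pow_succ']; exact mul_dvd_mul_left _ hc
        · rwa [← pow_succ', ← mul_assoc]
    · exact (pow_dvd_pow _ (by omega)).trans (hp.pow_dvd_of_dvd_mul_left r hpa h)

theorem pow_sub_dvd_intBinom {p : ℕ} (hp : p.Prime) {r t : ℕ} {n k : ℤ} (hn : (p : ℤ) ^ r ∣ n)
    (hk : ¬ (p : ℤ) ^ (t + 1) ∣ k) : (p : ℤ) ^ (r - t) ∣ intBinom n k := by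
  refine (Nat.prime_iff_prime_int.mp hp).pow_sub_dvd_of_pow_dvd_mul hk ?_
  rw [mul_intBinom]
  exact hn.mul_right _

theorem pow_sub_dvd_blockTerm {p : ℕ} (hp : p.Prime) {r t m : ℕ} (hm : 0 < m) {v : Fin m → ℤ}
    {k : ℤ} (hv : ∀ i, (p : ℤ) ^ r ∣ v i) (hk : ¬ (p : ℤ) ^ (t + 1) ∣ k) :
    (p : ℤ) ^ (r - t) ∣ blockTerm v k := by
  obtain ⟨m, rfl⟩ : ∃ m', m = m' + 1 := ⟨m - 1, by omega⟩
  rw [blockTerm_succ]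
  exact (pow_sub_dvd_intBinom hp (hv 0) hk).mul_right _

theorem pow_dvd_aperyTerm {p : ℕ} (hp : p.Prime) {r t l : ℕ} {lam : Fin l → ℕ}
    (hlam : ∀ j, 0 < lam j) {n : Fin (∑ j, lam j) → ℤ} {k : ℤ} (hn : ∀ i, (p : ℤ) ^ r ∣ n i)
    (hk : ¬ (p : ℤ) ^ (t + 1) ∣ k) : (p : ℤ) ^ ((r - t) * l) ∣ aperyTerm lam n k := by
  have h : ∏ _j : Fin l, (p : ℤ) ^ (r - t) = (p : ℤ) ^ ((r - t) * l) := by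
    rw [Finset.prod_const, Finset.card_univ, Fintype.card_fin, pow_mul]
  rw [aperyTerm_eq_prod_blockTerm, ← h]
  exact Finset.prod_dvd_prod_of_dvd _ _ fun j _ => pow_sub_dvd_blockTerm hp (hlam j) (fun _ => hn _) hk

theorem two_dvd_intBinom {n k : ℤ} (hn : 2 ∣ n) (hk : ¬ 2 ∣ k) : 2 ∣ intBinom n k := by
  simpa using pow_sub_dvd_intBinom Nat.prime_two (r := 1) (t := 0) (by simpa using hn)
    (by simpa using hk)

/-- A third entry supplies one more factor `2`, from the binomial of `(v 1 - k) + (v 2 - k)` over `v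
1 - k`, which is an even number over an odd one. -/
theorem two_pow_succ_dvd_blockTerm {r m : ℕ} {v : Fin (m + 3) → ℤ} {k : ℤ} (hr : 1 ≤ r)
    (hv : ∀ i, (2 : ℤ) ^ r ∣ v i) (hk : ¬ (2 : ℤ) ∣ k) : (2 : ℤ) ^ (r + 1) ∣ blockTerm v k := by
  rw [blockTerm_succ, pow_succ]
  have hv2 : ∀ i, (2 : ℤ) ∣ v i := fun i => (dvd_pow_self _ (by omega)).trans (hv i)
  refine mul_dvd_mul (pow_sub_dvd_intBinom Nat.prime_two (t := 0) (hv 0) (by simpa using hk)) ?_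
  rw [List.ofFn_succ, List.ofFn_succ]
  have h : ∀ a b c : ℤ, ∀ L : List ℤ, (a :: b :: c :: L).Perm (b :: c :: a :: L) := fun a b c L =>
    (List.Perm.swap b a _).trans ((List.Perm.swap c a _).cons b)
  rw [intMultinomial_perm (h _ _ _ _), intMultinomial_cons_cons]
  refine (two_dvd_intBinom ?_ ?_).mul_right _
  · have h1 := hv2 (Fin.succ 0)
    have h2 := hv2 (Fin.succ (Fin.succ 0))
    omega
  · have h1 := hv2 (Fin.succ 0)
    omega

/-! ### Comparison of the terms at `p k` and `k` -/

section Padic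

variable {p : ℕ} [Fact p.Prime]

/-- The quotient of `intMultinomial (b.map (p * ·))` by `intMultinomial b`. -/
noncomputable def multinomialUnit (p : ℕ) [Fact p.Prime] (b : List ℤ) : ℤ_[p]ˣ :=
  primeFactorial p (p * b.sum) / (b.map fun c => primeFactorial p (p * c)).prod

theorem intMultinomial_map_mul (b : List ℤ) :
    (intMultinomial (b.map ((p : ℤ) * ·)) : ℤ_[p]) =
      intMultinomial b * (multinomialUnit p b : ℤ_[p]) := by
  have hp : (p : ℤ) ≠ 0 := by exact_mod_cast (Fact.out : p.Prime).ne_zero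
  have hmap : (b.map ((p : ℤ) * ·)).map (· / (p : ℤ)) = b := by
    rw [List.map_map]
    conv_rhs => rw [← List.map_id b]
    congr 1
    funext c
    exact Int.mul_ediv_cancel_left _ hp
  have hsum : (b.map ((p : ℤ) * ·)).sum = p * b.sum := List.sum_map_mul_left ..|>.trans (by simp)
  have h := intMultinomial_mul_prod_primeFactorial (p := p) (b.map ((p : ℤ) * ·)) (by
    rw [hmap, hsum, Int.mul_ediv_cancel_left _ hp])
  rw [hmap, hsum, List.map_map] at h
  rw [multinomialUnit, div_eq_mul_inv, Units.val_mul, ← mul_assoc, ← h, mul_assoc, ← Units.val_mul]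
  simp [Function.comp_def]

/-- The residue of `multinomialUnit p b` modulo `p ^ e`. -/
noncomputable def multinomialUnitMod (p : ℕ) [Fact p.Prime] (e : ℕ) (b : List ℤ) :
    (ZMod (p ^ e))ˣ :=
  primeFactorialMod p e (p * b.sum) / (b.map fun c => primeFactorialMod p e (p * c)).prod

theorem map_multinomialUnit (e : ℕ) (b : List ℤ) :
    Units.map (PadicInt.toZModPow e : ℤ_[p] →+* ZMod (p ^ e)).toMonoidHom (multinomialUnit p b) =
      multinomialUnitMod p e b := by
  rw [multinomialUnit, multinomialUnitMod, map_div, map_list_prod, List.map_map]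
  rfl

/-- The arguments of the multinomial coefficient that belongs to a block `v`. -/
def blockList {m : ℕ} (v : Fin m → ℤ) (k : ℤ) : List ℤ := List.ofFn (fun i => v i - k) ++ [k]

theorem blockTerm_eq {m : ℕ} (v : Fin m → ℤ) (k : ℤ) :
    blockTerm v k = intMultinomial (blockList v k) := rfl

theorem blockTerm_mul {m : ℕ} (v : Fin m → ℤ) (k : ℤ) :
    (blockTerm (fun i => (p : ℤ) * v i) (p * k) : ℤ_[p]) =
      blockTerm v k * (multinomialUnit p (blockList v k) : ℤ_[p]) := by
  rw [blockTerm_eq, blockTerm_eq, ← intMultinomial_map_mul]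
  congr 2
  simp [blockList, List.map_append, List.map_ofFn, Function.comp_def, mul_sub]

theorem pow_dvd_aperyTerm_mul_sub {l : ℕ} {lam : Fin l → ℕ} {n : Fin (∑ j, lam j) → ℤ} {k : ℤ}
    {a c : ℕ} (ha : (p : ℤ) ^ a ∣ aperyTerm lam n k)
    (hc : ∏ j, multinomialUnitMod p c (blockList (fun i => n (finSigmaFinEquiv ⟨j, i⟩)) k) = 1) :
    (p : ℤ) ^ (a + c) ∣ aperyTerm lam ((p : ℤ) • n) (p * k) - aperyTerm lam n k := by
  rw [← PadicInt.pow_p_dvd_int_iff]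
  set U := ∏ j, multinomialUnit p (blockList (fun i => n (finSigmaFinEquiv ⟨j, i⟩)) k) with hU
  have h1 : (aperyTerm lam ((p : ℤ) • n) (p * k) : ℤ_[p]) = aperyTerm lam n k * (U : ℤ_[p]) := by
    rw [aperyTerm_eq_prod_blockTerm, aperyTerm_eq_prod_blockTerm, hU, Units.coe_prod, Int.cast_prod,
      Int.cast_prod, ← Finset.prod_mul_distrib]
    exact Finset.prod_congr rfl fun j _ => blockTerm_mul _ _
  have h2 : (p : ℤ_[p]) ^ c ∣ (U : ℤ_[p]) - 1 := by
    rw [← Ideal.mem_span_singleton, ← PadicInt.ker_toZModPow, RingHom.mem_ker, map_sub, map_one,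
      sub_eq_zero]
    have h3 : Units.map (PadicInt.toZModPow c : ℤ_[p] →+* ZMod (p ^ c)).toMonoidHom U = 1 := by
      rw [hU, map_prod]
      simpa only [map_multinomialUnit] using hc
    exact congrArg Units.val h3
  have h3 : (p : ℤ_[p]) ^ a ∣ (aperyTerm lam n k : ℤ_[p]) := by
    rwa [PadicInt.pow_p_dvd_int_iff]
  have h4 : ((aperyTerm lam ((p : ℤ) • n) (p * k) - aperyTerm lam n k : ℤ) : ℤ_[p]) =
      aperyTerm lam n k * ((U : ℤ_[p]) - 1) := by rw [Int.cast_sub, h1]; ring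
  rw [h4, pow_add]
  exact mul_dvd_mul h3 h2

theorem primeFactorialMod_list_sum {e : ℕ} {d : ℤ}
    (H : ∀ x y, d ∣ x → d ∣ y → primeFactorialMod p e (x + y) =
      primeFactorialMod p e x * primeFactorialMod p e y) (b : List ℤ) (hb : ∀ c ∈ b, d ∣ p * c) :
    multinomialUnitMod p e b = 1 := by
  rw [multinomialUnitMod, div_eq_one]
  have key : d ∣ p * b.sum ∧ primeFactorialMod p e (p * b.sum) =
      (b.map fun c => primeFactorialMod p e (p * c)).prod := by
    induction b with
    | nil => simp
    | cons a L ih =>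
      obtain ⟨h1, h2⟩ := ih fun c hc => hb c (List.mem_cons_of_mem _ hc)
      have h3 := hb a List.mem_cons_self
      rw [List.sum_cons, mul_add, H _ _ h3 h1, h2]
      exact ⟨dvd_add h3 h1, by simp⟩
  exact key.2

/-- With at most two entries, the total `∑ v i - (m - 1) k` contains `k` at most once. Additivity is
then needed only when one summand is a multiple of `d'`, and after cancelling the factors of the `v
i` only the pair `p k`, `-p k` survives. -/
theorem multinomialUnitMod_blockList_mul {e : ℕ} {d d' : ℤ} (hd : d ∣ d')
    (H : ∀ x y, d' ∣ x → d ∣ y → primeFactorialMod p e (x + y) =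
      primeFactorialMod p e x * primeFactorialMod p e y) {m : ℕ} (hm : 0 < m) (hm2 : m ≤ 2)
    {v : Fin m → ℤ} {k : ℤ} (hv : ∀ i, d' ∣ p * v i) (hk : d ∣ p * k) :
    multinomialUnitMod p e (blockList v k) *
      (primeFactorialMod p e (p * k) * primeFactorialMod p e (-(p * k))) = 1 := by
  have hk' : d ∣ -(p * k) := hk.neg_right
  have hsub : ∀ i, primeFactorialMod p e (p * (v i - k)) =
      primeFactorialMod p e (p * v i) * primeFactorialMod p e (-(p * k)) := by
    intro i
    rw [← H _ _ (hv i) hk']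
    congr 1; ring
  obtain rfl | rfl : m = 1 ∨ m = 2 := by omega
  · have e1 : blockList v k = [v 0 - k, k] := by simp [blockList]
    have e2 : (p : ℤ) * [v 0 - k, k].sum = p * v 0 := by simp
    rw [e1, multinomialUnitMod, e2]
    simp only [List.map_cons, List.map_nil, List.prod_cons, List.prod_nil, mul_one, hsub]
    rw [div_mul_eq_mul_div, div_eq_one]
    apply Units.ext
    push_cast
    ring
  · have e1 : blockList v k = [v 0 - k, v 1 - k, k] := by simp [blockList]
    have e2 : (p : ℤ) * [v 0 - k, v 1 - k, k].sum = p * v 0 + (p * v 1 + -(p * k)) := by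
      simp; ring
    rw [e1, multinomialUnitMod, e2, H _ _ (hv 0) (dvd_add (hd.trans (hv 1)) hk'), H _ _ (hv 1) hk']
    simp only [List.map_cons, List.map_nil, List.prod_cons, List.prod_nil, mul_one, hsub]
    rw [div_mul_eq_mul_div, div_eq_one]
    apply Units.ext
    push_cast
    ring

theorem Int.exists_pow_dvd_and (q k : ℤ) (R : ℕ) :
    ∃ t ≤ R, q ^ t ∣ k ∧ (t = R ∨ ¬ q ^ (t + 1) ∣ k) := by
  induction R with
  | zero => exact ⟨0, le_rfl, by simp, Or.inl rfl⟩
  | succ R ih =>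
    obtain ⟨t, h1, h2, h3⟩ := ih
    by_cases h4 : q ^ (t + 1) ∣ k
    · have h5 : t = R := h3.resolve_right (not_not.mpr h4)
      exact ⟨R + 1, le_rfl, h5 ▸ h4, Or.inl rfl⟩
    · exact ⟨t, by omega, h2, Or.inr h4⟩

theorem pow_dvd_aperyTerm_of_or {r t l : ℕ} (hl : 2 ≤ l) {lam : Fin l → ℕ}
    (hlam : ∀ j, 0 < lam j) {n : Fin (∑ j, lam j) → ℤ} {k : ℤ} (hn : ∀ i, (p : ℤ) ^ r ∣ n i)
    (hk : t = r ∨ ¬ (p : ℤ) ^ (t + 1) ∣ k) : (p : ℤ) ^ (2 * (r - t)) ∣ aperyTerm lam n k := by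
  rcases hk with rfl | hk
  · simp
  · refine (pow_dvd_pow _ ?_).trans (pow_dvd_aperyTerm Fact.out hlam hn hk)
    rw [mul_comm]
    exact Nat.mul_le_mul_left _ hl

theorem dvd_mul_of_mem_blockList {m : ℕ} {v : Fin m → ℤ} {k d : ℤ} (hv : ∀ i, d ∣ v i)
    (hk : d ∣ k) (q : ℤ) : ∀ c ∈ blockList v k, q * d ∣ q * c := by
  intro c hc
  refine mul_dvd_mul_left _ ?_
  rw [blockList, List.mem_append, List.mem_ofFn, List.mem_singleton] at hc
  rcases hc with ⟨i, rfl⟩ | rfl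
  · exact dvd_sub (hv i) hk
  · exact hk

/-- The exponents add up as `2 (R - t) + 2 (t + 1) = 2 (R + 1)`: what the term loses through `p ^ t
∣ k`, the unit regains. -/
theorem pow_dvd_aperyTerm_prime_mul_sub_of_ne {R t l : ℕ} (hl : 2 ≤ l) {lam : Fin l → ℕ}
    (hlam : ∀ j, 0 < lam j) {n : Fin (∑ j, lam j) → ℤ} {k : ℤ} (hn : ∀ i, (p : ℤ) ^ R ∣ n i)
    (htR : t ≤ R) (htk : (p : ℤ) ^ t ∣ k) (hk : t = R ∨ ¬ (p : ℤ) ^ (t + 1) ∣ k)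
    (hp : p ^ (t + 1) ≠ 2) :
    (p : ℤ) ^ (2 * (R + 1)) ∣ aperyTerm lam ((p : ℤ) • n) (p * k) - aperyTerm lam n k := by
  have h := pow_dvd_aperyTerm_mul_sub (c := (t + 1) + (t + 1)) (pow_dvd_aperyTerm_of_or hl hlam hn hk)
    (Finset.prod_eq_one fun j _ => primeFactorialMod_list_sum (d := (p : ℤ) ^ (t + 1))
      (fun x y hx hy => primeFactorialMod_add (by omega) le_rfl hp hx hy) _ ?_)
  · refine (pow_dvd_pow _ ?_).trans h
    omega
  · rw [pow_succ']
    exact dvd_mul_of_mem_blockList (fun i => (pow_dvd_pow _ htR).trans (hn _)) htk _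

theorem pow_dvd_aperyTerm_prime_mul_sub_of_five_le (hp5 : 5 ≤ p) {R l : ℕ} (hl : 2 ≤ l)
    {lam : Fin l → ℕ} (hlam : ∀ j, 0 < lam j) (hlam2 : ∀ j, lam j ≤ 2)
    {n : Fin (∑ j, lam j) → ℤ} (hn : ∀ i, (p : ℤ) ^ R ∣ n i) (k : ℤ) :
    (p : ℤ) ^ (3 * (R + 1)) ∣ aperyTerm lam ((p : ℤ) • n) (p * k) - aperyTerm lam n k := by
  obtain ⟨t, htR, htk, hk⟩ := Int.exists_pow_dvd_and p k R
  -- The exponents add up to `2 (R - t) + (R + 1) + 2 (t + 1) = 3 (R + 1)`.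
  have h := pow_dvd_aperyTerm_mul_sub (c := (R + 1) + 2 * (t + 1))
    (pow_dvd_aperyTerm_of_or hl hlam hn hk) (Finset.prod_eq_one fun j _ => ?_)
  · refine (pow_dvd_pow _ ?_).trans h
    omega
  · have h1 := multinomialUnitMod_blockList_mul (p := p) (e := (R + 1) + 2 * (t + 1))
      (pow_dvd_pow (p : ℤ) (by omega : t + 1 ≤ R + 1))
      (fun x y hx hy => primeFactorialMod_add_of_five_le hp5 (by omega) (by omega) hx hy)
      (hlam j) (hlam2 j) (v := fun i => n (finSigmaFinEquiv ⟨j, i⟩)) (k := k)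
      (fun i => by rw [pow_succ']; exact mul_dvd_mul_left _ (hn _))
      (by rw [pow_succ']; exact mul_dvd_mul_left _ htk)
    have h2 : primeFactorialMod p (R + 1 + 2 * (t + 1)) (p * k) *
        primeFactorialMod p (R + 1 + 2 * (t + 1)) (-(p * k)) = 1 := by
      rw [primeFactorialMod, primeFactorialMod, ← map_mul,
        primeFactorial_mul_neg (by omega) (dvd_mul_right _ _), map_one]
    rwa [h2, mul_one] at h1

/-- An even number over an odd one is an even binomial. Hence in an odd multinomial coefficient each
entry or the sum of the entries after it is even; its double is a multiple of `4`, and the factorial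
modulo `4` splits there. -/
theorem multinomialUnitMod_two_of_odd (b : List ℤ) (hb : ¬ 2 ∣ intMultinomial b) :
    multinomialUnitMod 2 2 b = 1 := by
  rw [multinomialUnitMod, div_eq_one]
  induction b with
  | nil => simp
  | cons a L ih =>
    rw [intMultinomial] at hb
    rw [List.map_cons, List.prod_cons, ← ih fun h => hb (h.mul_left _), List.sum_cons, mul_add]
    by_cases ha : 2 ∣ a
    · exact primeFactorialMod_add_right (by norm_num)
        (by obtain ⟨c, rfl⟩ := ha; exact ⟨c, by push_cast; ring⟩) _
    · have hL : 2 ∣ L.sum := by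
        by_contra hL
        exact hb ((two_dvd_intBinom (by omega) ha).mul_right _)
      rw [add_comm, primeFactorialMod_add_right (by norm_num)
          (by obtain ⟨c, hc⟩ := hL; exact ⟨c, by rw [hc]; push_cast; ring⟩),
        mul_comm]

theorem units_zmod_two_pow_one (u : (ZMod (2 ^ 1))ˣ) : u = 1 := by
  revert u; decide

theorem two_pow_dvd_aperyTerm_two_mul_sub {R l : ℕ} (hl : 2 ≤ l) {lam : Fin l → ℕ}
    (hlam : ∀ j, 0 < lam j) {n : Fin (∑ j, lam j) → ℤ} (hn : ∀ i, (2 : ℤ) ^ R ∣ n i) (k : ℤ) :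
    (2 : ℤ) ^ (2 * (R + 1)) ∣ aperyTerm lam ((2 : ℤ) • n) (2 * k) - aperyTerm lam n k := by
  obtain ⟨t, htR, htk, hk⟩ := Int.exists_pow_dvd_and 2 k R
  -- The pairing argument covers `t ≥ 1`. At `t = 0` it would need `q = 2`, where the midpoint `1`
  -- is odd.
  by_cases ht : t = 0
  swap
  · refine pow_dvd_aperyTerm_prime_mul_sub_of_ne (p := 2) hl hlam hn htR htk hk ?_
    rw [pow_succ]
    have := Nat.pow_le_pow_right (by norm_num : 0 < 2) (Nat.one_le_iff_ne_zero.mpr ht)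
    omega
  subst ht
  -- Every unit is `1` modulo `2`, so a single surplus factor `2` in the term suffices.
  have key1 : ∀ a, 2 * R + 1 ≤ a → (2 : ℤ) ^ a ∣ aperyTerm lam n k →
      (2 : ℤ) ^ (2 * (R + 1)) ∣ aperyTerm lam ((2 : ℤ) • n) (2 * k) - aperyTerm lam n k :=
    fun a ha h => (pow_dvd_pow _ (by omega)).trans
      (pow_dvd_aperyTerm_mul_sub (p := 2) (c := 1) h (units_zmod_two_pow_one _))
  rcases Nat.eq_zero_or_pos R with rfl | hR
  · by_cases hT : 2 ∣ aperyTerm lam n k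
    · exact key1 1 le_rfl (by simpa using hT)
    · refine (pow_dvd_aperyTerm_mul_sub (p := 2) (a := 0) (c := 2) (by simp)
        (Finset.prod_eq_one fun j _ => multinomialUnitMod_two_of_odd _ fun h => hT ?_))
      exact h.trans (Finset.dvd_prod_of_mem _ (Finset.mem_univ j))
  · have hk2 : ¬ (2 : ℤ) ^ (0 + 1) ∣ k := hk.resolve_left (by omega)
    rcases Nat.lt_or_ge 2 l with hl3 | hl3
    · refine key1 _ ?_ (pow_dvd_aperyTerm Nat.prime_two hlam hn hk2)
      rw [Nat.sub_zero]
      nlinarith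
    obtain rfl : l = 2 := by omega
    by_cases hj : ∃ j, 3 ≤ lam j
    · obtain ⟨j0, hj0⟩ := hj
      refine key1 _ le_rfl ?_
      have h1 : ∏ j : Fin 2, (2 : ℤ) ^ (R + if j = j0 then 1 else 0) = 2 ^ (2 * R + 1) := by
        rw [Finset.prod_pow_eq_pow_sum, Finset.sum_add_distrib]
        simp
      rw [← h1, aperyTerm_eq_prod_blockTerm]
      refine Finset.prod_dvd_prod_of_dvd _ _ fun j _ => ?_
      generalize hv : (fun i => n (finSigmaFinEquiv ⟨j, i⟩)) = v
      have hvd : ∀ i, (2 : ℤ) ^ R ∣ v i := fun i => by rw [← hv]; exact hn _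
      clear hv
      split_ifs with h
      · subst h
        revert v
        obtain ⟨m, hm⟩ : ∃ m, lam j = m + 3 := ⟨lam j - 3, by omega⟩
        rw [hm]
        intro v hv
        exact two_pow_succ_dvd_blockTerm hR hv (by simpa using hk2)
      · exact pow_sub_dvd_blockTerm Nat.prime_two (t := 0) (hlam j) hvd hk2
    -- No surplus factor is available here. Modulo `4` both blocks have the same unit, the inverse
    -- of `G(2 k) G(-2 k)`, and its square is `1` by reflection.
    · push Not at hj
      have h := pow_dvd_aperyTerm_mul_sub (p := 2) (c := 2)
        (pow_dvd_aperyTerm Nat.prime_two hlam hn hk2) ?_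
      · exact (pow_dvd_pow _ (by omega)).trans h
      · have h1 : ∀ j, multinomialUnitMod 2 2 (blockList (fun i => n (finSigmaFinEquiv ⟨j, i⟩)) k) =
            (primeFactorialMod 2 2 ((2 : ℕ) * k) * primeFactorialMod 2 2 (-((2 : ℕ) * k)))⁻¹ := by
          intro j
          rw [eq_inv_iff_mul_eq_one]
          refine multinomialUnitMod_blockList_mul (d := 1) (d' := ((2 : ℕ) : ℤ) ^ 2) (one_dvd _)
            (fun x y hx _ => primeFactorialMod_add_right (by norm_num) hx y) (hlam j)
            (by have := hj j; omega) (fun i => ?_) (one_dvd _)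
          rw [pow_two]
          exact mul_dvd_mul_left _ ((dvd_pow_self _ (by omega)).trans (hn _))
        simp only [h1]
        rw [Finset.prod_const, Finset.card_univ, Fintype.card_fin, inv_pow, inv_eq_one,
          primeFactorialMod, primeFactorialMod, ← map_mul, ← map_pow, primeFactorial_mul_neg_sq,
          map_one]
        exact dvd_mul_right _ _

theorem pow_dvd_aperyTerm_prime_mul_sub {R l : ℕ} (hl : 2 ≤ l) {lam : Fin l → ℕ}
    (hlam : ∀ j, 0 < lam j) {n : Fin (∑ j, lam j) → ℤ} (hn : ∀ i, (p : ℤ) ^ R ∣ n i) (k : ℤ) :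
    (p : ℤ) ^ (2 * (R + 1)) ∣ aperyTerm lam ((p : ℤ) • n) (p * k) - aperyTerm lam n k := by
  have hp2 := (Fact.out : p.Prime).two_le
  rcases hp2.eq_or_lt with rfl | h3
  · exact two_pow_dvd_aperyTerm_two_mul_sub hl hlam hn k
  · obtain ⟨t, htR, htk, hk⟩ := Int.exists_pow_dvd_and p k R
    refine pow_dvd_aperyTerm_prime_mul_sub_of_ne hl hlam hn htR htk hk ?_
    have := Nat.pow_le_pow_right (by omega : 0 < p) (by omega : 1 ≤ t + 1)
    rw [pow_one] at this
    omega

end Padic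

/-! ### Cancellation among the terms with index prime to `p` -/

theorem Finset.sum_Ico_natCast_mul {M : Type*} [AddCommMonoid M] (q : ℕ) (g : ℤ → M) {A B : ℤ}
    (hAB : A ≤ B) : ∑ m ∈ Finset.Ico (q * A) (q * B), g m =
      ∑ m ∈ Finset.Ico A B, ∑ i ∈ Finset.range q, g (q * m + i) := by
  have hone : ∀ (a : ℤ) (n : ℕ), ∑ m ∈ Finset.Ico a (a + n), g m =
      ∑ i ∈ Finset.range n, g (a + i) := by
    intro a n
    refine Finset.sum_nbij' (fun m => (m - a).toNat) (fun i => a + i) ?_ ?_ ?_ ?_ ?_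
    · intro m hm; rw [Finset.mem_Ico] at hm; rw [Finset.mem_range]; omega
    · intro i hi; rw [Finset.mem_range] at hi; rw [Finset.mem_Ico]; omega
    · intro m hm; rw [Finset.mem_Ico] at hm; omega
    · intro i hi; simp
    · intro m hm; rw [Finset.mem_Ico] at hm; congr 1; omega
  induction B, hAB using Int.leInduction with
  | base => simp
  | succ B hAB ih =>
    have h1 : Finset.Ico A (B + 1) = insert B (Finset.Ico A B) := by
      ext x; simp only [Finset.mem_insert, Finset.mem_Ico]; omega
    have h2 : (q : ℤ) * A ≤ q * B := mul_le_mul_of_nonneg_left hAB (by positivity)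
    have h3 : (q : ℤ) * B ≤ q * B + q := by omega
    rw [h1, Finset.sum_insert (by simp), ← ih, mul_add, mul_one, ← hone,
      add_comm (∑ m ∈ Finset.Ico ((q : ℤ) * B) _, g m),
      ← Finset.Ico_union_Ico_eq_Ico h2 h3,
      Finset.sum_union (Finset.Ico_disjoint_Ico_consecutive _ _ _)]

section Padic

variable {p : ℕ} [Fact p.Prime]

/-- Induction on the level. Replacing `f (r + 1) m` by `f r (m / p)` costs a multiple of `p ^ (r +
1)`. The new factor is constant on intervals of length `p`, and summing `w` over these gives weights
for level `r` with `e + 1` in place of `e`. -/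
theorem pow_dvd_sum_mul_of_tower (f : ℕ → ℤ → ℤ_[p])
    (hf : ∀ i m, (p : ℤ_[p]) ^ (i + 1) ∣ f (i + 1) m - f i (m / p)) {K : ℤ} (hK : 0 ≤ K) (r : ℕ) :
    ∀ (e : ℕ) (w : ℤ → ℤ_[p]), (∀ s ≤ r, ∀ M : ℤ, (p : ℤ_[p]) ^ (e + s) ∣
      ∑ m ∈ Finset.Ico ((p ^ s : ℕ) * M) ((p ^ s : ℕ) * (M + 1)), w m) →
      (p : ℤ_[p]) ^ (e + r) ∣
        ∑ m ∈ Finset.Ico ((p ^ r : ℕ) * -K) ((p ^ r : ℕ) * K), f r m * w m := by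
  have hp : (0 : ℤ) < p := by exact_mod_cast (Fact.out : p.Prime).pos
  induction r with
  | zero =>
    intro e w hw
    refine Finset.dvd_sum fun m _ => Dvd.dvd.mul_left ?_ _
    have h1 := hw 0 le_rfl m
    have h2 : Finset.Ico m (m + 1) = {m} := by ext; simp; omega
    simpa [h2] using h1
  | succ r ih =>
    intro e w hw
    have hsplit : ∀ m, f (r + 1) m * w m = (f (r + 1) m - f r (m / p)) * w m + f r (m / p) * w m :=
      fun m => by ring
    simp only [hsplit]
    rw [Finset.sum_add_distrib]
    refine dvd_add (Finset.dvd_sum fun m _ => ?_) ?_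
    · have h1 := hw 0 (by omega) m
      have h2 : Finset.Ico m (m + 1) = {m} := by ext; simp; omega
      rw [add_comm, pow_add]
      exact mul_dvd_mul (hf r m) (by simpa [h2] using h1)
    · have h3 : ∀ x : ℤ, ((p ^ (r + 1) : ℕ) : ℤ) * x = p * ((p ^ r : ℕ) * x) := by
        intro x; push_cast; ring
      rw [h3, h3, Finset.sum_Ico_natCast_mul p _
        (mul_le_mul_of_nonneg_left (by omega) (by positivity))]
      have h4 : ∀ m : ℤ, ∑ i ∈ Finset.range p, f r ((p * m + i) / p) * w (p * m + i) =
          f r m * ∑ i ∈ Finset.range p, w (p * m + i) := by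
        intro m
        rw [Finset.mul_sum]
        refine Finset.sum_congr rfl fun i hi => ?_
        rw [Finset.mem_range] at hi
        rw [add_comm ((p : ℤ) * m), Int.add_mul_ediv_left _ _ hp.ne',
          Int.ediv_eq_zero_of_lt (by positivity) (by exact_mod_cast hi), zero_add]
      simp only [h4]
      rw [show e + (r + 1) = e + 1 + r by ring]
      refine ih (e + 1) (fun m => ∑ i ∈ Finset.range p, w (p * m + i)) fun s hs M => ?_
      rw [← Finset.sum_Ico_natCast_mul p w
        (mul_le_mul_of_nonneg_left (by omega) (by positivity))]
      have h5 := hw (s + 1) (by omega) M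
      rw [show e + 1 + s = e + (s + 1) by ring]
      convert h5 using 3 <;> (push_cast; ring)

theorem toZModPow_eq_zero_iff {e : ℕ} {x : ℤ_[p]} :
    PadicInt.toZModPow e x = 0 ↔ (p : ℤ_[p]) ^ e ∣ x := by
  rw [← RingHom.mem_ker, PadicInt.ker_toZModPow, Ideal.mem_span_singleton]

theorem isUnit_intCast_zmod {s : ℕ} {j : ℤ} (h : ¬ (p : ℤ) ∣ j) : IsUnit (j : ZMod (p ^ s)) := by
  have := (PadicInt.isUnit_intCast_iff.mpr h).map (PadicInt.toZModPow s : ℤ_[p] →+* ZMod (p ^ s))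
  rwa [map_intCast] at this

theorem ringInverse_intCast_of_dvd {s : ℕ} {j : ℤ} (hs : 1 ≤ s) (h : (p : ℤ) ∣ j) :
    Ring.inverse (j : ZMod (p ^ s)) = 0 := by
  refine Ring.inverse_non_unit _ fun hu => ?_
  obtain ⟨c, rfl⟩ := h
  rw [Int.cast_mul, Int.cast_natCast] at hu
  have h1 := isUnit_of_mul_isUnit_left hu
  have h2 := ringInverse_natCast_of_dvd (p := p) hs (dvd_refl p)
  have h3 := Ring.mul_inverse_cancel _ h1
  rw [h2, mul_zero] at h3
  have h4 : ((1 : ℕ) : ZMod (p ^ s)) = 0 := by simpa using h3.symm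
  rw [ZMod.natCast_eq_zero_iff, Nat.dvd_one, Nat.pow_eq_one] at h4
  have := (Fact.out : p.Prime).one_lt
  omega

theorem toZModPow_ringInverse {s : ℕ} (hs : 1 ≤ s) (j : ℤ) :
    PadicInt.toZModPow s (Ring.inverse (j : ℤ_[p])) = Ring.inverse (j : ZMod (p ^ s)) := by
  by_cases h : (p : ℤ) ∣ j
  · rw [Ring.inverse_non_unit _ (mt PadicInt.isUnit_intCast_iff.mp (not_not.mpr h)), map_zero,
      ringInverse_intCast_of_dvd hs h]
  · have h1 := congrArg (PadicInt.toZModPow s)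
      (Ring.mul_inverse_cancel _ (PadicInt.isUnit_intCast_iff.mpr h))
    rw [map_mul, map_intCast, map_one] at h1
    have h2 := Ring.mul_inverse_cancel _ (isUnit_intCast_zmod (s := s) h)
    exact (isUnit_intCast_zmod (s := s) h).mul_left_cancel (h1.trans h2.symm)

/-- For `ε = 1` this is the full sum of inverse squares. For `ε = -1`, the reflection `j ↦ p ^ s -
j` keeps the squares and flips the sign, since `p ^ s` is odd. -/
theorem sum_range_sign_mul_ringInverse_sq (hp5 : 5 ≤ p) {s : ℕ} (hs : 1 ≤ s) (ε : ℤˣ) :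
    ∑ i ∈ Finset.range (p ^ s), (((ε ^ (i + 1) : ℤˣ) : ℤ) : ZMod (p ^ s)) *
      Ring.inverse (((i + 1 : ℕ)) : ZMod (p ^ s)) ^ 2 = 0 := by
  have hp : p.Prime := Fact.out
  set h : ℕ → ZMod (p ^ s) := fun j => (((ε ^ j : ℤˣ) : ℤ) : ZMod (p ^ s)) *
    Ring.inverse (j : ZMod (p ^ s)) ^ 2 with hh
  have h0 : h 0 = 0 := by
    simp only [hh]; rw [ringInverse_natCast_of_dvd hs (dvd_zero p)]; simp
  have hq : h (p ^ s) = 0 := by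
    simp only [hh]; rw [ringInverse_natCast_of_dvd hs (dvd_pow_self p (by omega))]; simp
  have hshift : ∑ i ∈ Finset.range (p ^ s), h (i + 1) = ∑ i ∈ Finset.range (p ^ s), h i := by
    have h1 := Finset.sum_range_succ h (p ^ s)
    rw [Finset.sum_range_succ', h0, hq, add_zero, add_zero] at h1
    exact h1
  change ∑ i ∈ Finset.range (p ^ s), h (i + 1) = 0
  rcases Int.units_eq_one_or ε with rfl | rfl
  · rw [hshift]
    simp only [hh, one_pow, Units.val_one, Int.cast_one, one_mul]
    rw [sum_range_natCast_zmod (p ^ s) (fun x => Ring.inverse x ^ 2),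
      sum_ringInverse_sq_zmod_eq_zero hp5]
  · have hodd : Odd (p ^ s) := (hp.odd_of_ne_two (by omega)).pow
    have h2 : ∑ i ∈ Finset.range (p ^ s), h (i + 1) = -∑ i ∈ Finset.range (p ^ s), h (i + 1) := by
      conv_rhs => rw [hshift]
      rw [← Finset.sum_range_reflect, ← Finset.sum_neg_distrib]
      refine Finset.sum_congr rfl fun i hi => ?_
      rw [Finset.mem_range] at hi
      simp only [hh]
      have e1 : p ^ s - 1 - i + 1 = p ^ s - i := by omega
      have e2 : (-1 : ℤˣ) ^ (p ^ s - i) = -(-1) ^ i := by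
        rw [← mul_left_inj ((-1 : ℤˣ) ^ i), ← pow_add, Nat.sub_add_cancel hi.le, hodd.neg_one_pow,
          neg_mul, ← mul_pow]
        simp
      rw [e1, e2, Nat.cast_sub hi.le, ZMod.natCast_self, zero_sub, ringInverse_neg_sq]
      push_cast
      ring
    have hu : IsUnit ((2 : ℕ) : ZMod (p ^ s)) := isUnit_natCast_zmod
      (fun h => by have := Nat.le_of_dvd (by norm_num) h; omega)
    refine (hu.mul_right_eq_zero).mp ?_
    push_cast
    linear_combination h2

/-- The weight `ε ^ (m + 1) / (m + 1) ^ 2` if `p` does not divide `m + 1`, and `0` otherwise. -/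
noncomputable def signWeight (p : ℕ) [Fact p.Prime] (ε : ℤˣ) (m : ℤ) : ℤ_[p] :=
  (((ε ^ (m + 1) : ℤˣ) : ℤ) : ℤ_[p]) * Ring.inverse ((m + 1 : ℤ) : ℤ_[p]) ^ 2

theorem pow_dvd_sum_signWeight (hp5 : 5 ≤ p) (ε : ℤˣ) (s : ℕ) (M : ℤ) :
    (p : ℤ_[p]) ^ s ∣
      ∑ m ∈ Finset.Ico ((p ^ s : ℕ) * M) ((p ^ s : ℕ) * (M + 1)), signWeight p ε m := by
  rcases Nat.eq_zero_or_pos s with rfl | hs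
  · simp
  rw [Finset.sum_Ico_natCast_mul _ _ (by omega)]
  have h2 : Finset.Ico M (M + 1) = {M} := by ext; simp; omega
  rw [h2, Finset.sum_singleton, ← toZModPow_eq_zero_iff, map_sum]
  have h3 : ∀ i : ℕ, PadicInt.toZModPow s (signWeight p ε ((p ^ s : ℕ) * M + i)) =
      (((ε ^ (((p ^ s : ℕ) : ℤ) * M) : ℤˣ) : ℤ) : ZMod (p ^ s)) *
        ((((ε ^ (i + 1) : ℤˣ) : ℤ) : ZMod (p ^ s)) *
          Ring.inverse (((i + 1 : ℕ)) : ZMod (p ^ s)) ^ 2) := by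
    intro i
    rw [signWeight, map_mul, map_pow, toZModPow_ringInverse hs, map_intCast, add_assoc, zpow_add]
    have e1 : ((((p ^ s : ℕ) : ℤ) * M + (i + 1) : ℤ) : ZMod (p ^ s)) = ((i + 1 : ℕ) : ZMod (p ^ s)) := by
      rw [Int.cast_add, Int.cast_mul, Int.cast_natCast, ZMod.natCast_self]; push_cast; ring
    have e2 : ε ^ ((i : ℤ) + 1) = ε ^ (i + 1) := by rw [← zpow_natCast]; push_cast; rfl
    rw [e1, e2]
    push_cast
    ring
  simp only [h3]
  rw [← Finset.mul_sum, sum_range_sign_mul_ringInverse_sq hp5 hs, mul_zero]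

theorem map_intMultinomial_pair_mul {i : ℕ} {x y x' y' : ℤ} (hx : x / p = x') (hy : y / p = y')
    (hxy : (x + y) / p = x' + y') :
    (intMultinomial [x, y] : ZMod (p ^ i)) *
        (primeFactorialMod p i x * primeFactorialMod p i y : (ZMod (p ^ i))ˣ) =
      intMultinomial [x', y'] * (primeFactorialMod p i (x + y) : ZMod (p ^ i)) := by
  have h := intMultinomial_mul_prod_primeFactorial (p := p) [x, y] (by simp [hx, hy, hxy])
  have h2 := congrArg (PadicInt.toZModPow i) h
  simp only [List.map_cons, List.map_nil, List.prod_cons, List.prod_nil, mul_one, List.sum_cons,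
    List.sum_nil, add_zero, hx, hy, Units.val_mul, map_mul, map_intCast] at h2
  simpa only [Units.val_mul, coe_primeFactorialMod] using h2

theorem Int.pow_succ_mul_add_ediv (i : ℕ) (a y : ℤ) :
    ((p : ℤ) ^ (i + 1) * a + y) / p = (p : ℤ) ^ i * a + y / p := by
  have hp : (p : ℤ) ≠ 0 := by exact_mod_cast (Fact.out : p.Prime).ne_zero
  rw [pow_succ', mul_assoc, add_comm, Int.add_mul_ediv_left _ _ hp, add_comm]

/-- The lower entries `m` and `p ^ (i + 1) a - 1 - m` have floors that add up without carry, because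
`⌊(-1 - m) / p⌋ = -1 - ⌊m / p⌋`. This is why the index is shifted to `m = k - 1`. -/
theorem intBinom_pow_mul_sub_one (i : ℕ) (a m : ℤ) :
    (intBinom ((p : ℤ) ^ (i + 1) * a - 1) m : ZMod (p ^ (i + 1))) *
        (primeFactorialMod p (i + 1) m * primeFactorialMod p (i + 1) (-1 - m) :
          (ZMod (p ^ (i + 1)))ˣ) =
      intBinom ((p : ℤ) ^ i * a - 1) (m / p) := by
  have hp : (0 : ℤ) < p := by exact_mod_cast (Fact.out : p.Prime).pos
  have hm := Int.neg_one_sub_ediv hp m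
  have h0 := Int.neg_one_sub_ediv hp 0
  have h := map_intMultinomial_pair_mul (p := p) (i := i + 1) (x := m)
    (y := (p : ℤ) ^ (i + 1) * a + (-1 - m)) rfl (Int.pow_succ_mul_add_ediv i a _) (by
      rw [hm, show m + ((p : ℤ) ^ (i + 1) * a + (-1 - m)) = (p : ℤ) ^ (i + 1) * a + (-1 - 0) by ring,
        Int.pow_succ_mul_add_ediv, h0, Int.zero_ediv]
      ring)
  have hG : primeFactorialMod p (i + 1) (m + ((p : ℤ) ^ (i + 1) * a + (-1 - m))) =
      primeFactorialMod p (i + 1) ((p : ℤ) ^ (i + 1) * a) := by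
    rw [show m + ((p : ℤ) ^ (i + 1) * a + (-1 - m)) = (p : ℤ) ^ (i + 1) * a + -1 by ring,
      primeFactorialMod_add_right (by omega) (dvd_mul_right _ _)]
    have h1 := primeFactorial_add_one (p := p) (-1)
    rw [neg_add_cancel, primeFactorial_zero, primeUnit_of_dvd (dvd_zero _), mul_one] at h1
    rw [primeFactorialMod, primeFactorialMod, ← h1, map_one, mul_one]
  rw [hG, hm, primeFactorialMod_add_right (by omega) (dvd_mul_right _ _), intMultinomial_pair,
    intMultinomial_pair, mul_left_comm, Units.val_mul,
    mul_comm (primeFactorialMod p (i + 1) ((p : ℤ) ^ (i + 1) * a) : ZMod (p ^ (i + 1))),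
    ← mul_assoc] at h
  have h2 := (primeFactorialMod p (i + 1) ((p : ℤ) ^ (i + 1) * a)).isUnit.mul_right_cancel h
  rw [show m + ((p : ℤ) ^ (i + 1) * a + (-1 - m)) = (p : ℤ) ^ (i + 1) * a - 1 by ring,
    show m / p + ((p : ℤ) ^ i * a + (-1 - m / p)) = (p : ℤ) ^ i * a - 1 by ring] at h2
  exact h2

theorem intMultinomial_pow_mul_pair (i : ℕ) (a b m : ℤ) :
    (intMultinomial [(p : ℤ) ^ (i + 1) * a, (p : ℤ) ^ (i + 1) * b - (m + 1)] :
        ZMod (p ^ (i + 1))) =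
      intMultinomial [(p : ℤ) ^ i * a, (p : ℤ) ^ i * b - (m / p + 1)] := by
  have hp : (0 : ℤ) < p := by exact_mod_cast (Fact.out : p.Prime).pos
  have hm := Int.neg_one_sub_ediv hp m
  have e : ∀ j (m : ℤ), (p : ℤ) ^ j * b - (m + 1) = (p : ℤ) ^ j * b + (-1 - m) := fun j m => by ring
  have h0 := Int.pow_succ_mul_add_ediv (p := p) i a 0
  simp only [add_zero, Int.zero_ediv] at h0
  rw [e, e]
  have h := map_intMultinomial_pair_mul (p := p) (i := i + 1) (x := (p : ℤ) ^ (i + 1) * a)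
    (y := (p : ℤ) ^ (i + 1) * b + (-1 - m)) h0 (Int.pow_succ_mul_add_ediv i b _) (by
      rw [Int.pow_succ_mul_add_ediv, Int.pow_succ_mul_add_ediv])
  rw [primeFactorialMod_add_right (by omega) (dvd_mul_right _ a), hm] at h
  exact (Units.isUnit _).mul_right_cancel h

/-- A block with at most two entries, divided by `p ^ i / (m + 1)` for `k = m + 1`, is up to a sign
determined by `m / p` modulo `p ^ i`. -/
theorem exists_blockTerm_tower {m : ℕ} (hm : 0 < m) (hm2 : m ≤ 2) (v : Fin m → ℤ) :
    ∃ (c : ℤ) (β : ℕ → ℤ → ℤ),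
      (∀ i k, (k + 1) * blockTerm (fun j => (p : ℤ) ^ i * v j) (k + 1) = (p : ℤ) ^ i * (c * β i k)) ∧
      ∀ i k, (β (i + 1) k : ZMod (p ^ (i + 1))) *
          (primeFactorialMod p (i + 1) k * primeFactorialMod p (i + 1) (-1 - k) :
            (ZMod (p ^ (i + 1)))ˣ) = β i (k / p) := by
  obtain ⟨m, rfl⟩ : ∃ m', m = m' + 1 := ⟨m - 1, by omega⟩
  -- Absorption turns `(k + 1) * binom(p ^ i v 0, k + 1)` into `p ^ i v 0 * binom(p ^ i v 0 - 1,
  -- k)`, whence the constant `v 0`.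
  refine ⟨v 0, fun i k => intBinom ((p : ℤ) ^ i * v 0 - 1) k *
    intMultinomial ((p : ℤ) ^ i * v 0 :: List.ofFn fun j : Fin m => (p : ℤ) ^ i * v j.succ - (k + 1)),
    fun i k => ?_, fun i k => ?_⟩
  · rw [blockTerm_succ, ← mul_assoc, mul_intBinom, add_sub_cancel_right]
    ring
  · rw [Int.cast_mul, Int.cast_mul, mul_right_comm, intBinom_pow_mul_sub_one]
    congr 1
    obtain rfl | rfl : m = 0 ∨ m = 1 := by omega
    · simp [intMultinomial_singleton]
    · simp only [List.ofFn_succ, List.ofFn_zero]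
      exact intMultinomial_pow_mul_pair i _ _ k

theorem pow_dvd_sum_aperyTerm_of_five_le (hp5 : 5 ≤ p) {l : ℕ} (hl : 2 ≤ l) {lam : Fin l → ℕ}
    (hlam : ∀ j, 0 < lam j) (hlam2 : ∀ j, lam j ≤ 2) (ε : ℤˣ) (n : Fin (∑ j, lam j) → ℤ) (r : ℕ)
    {K : ℤ} (hK : 0 ≤ K) :
    (p : ℤ) ^ (3 * r) ∣ ∑ m ∈ Finset.Ico ((p ^ r : ℕ) * -K) ((p ^ r : ℕ) * K),
      if (p : ℤ) ∣ m + 1 then 0 else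
        ((ε ^ (m + 1) : ℤˣ) : ℤ) * aperyTerm lam ((p : ℤ) ^ r • n) (m + 1) := by
  rcases hl.lt_or_eq with hl3 | rfl
  · refine Finset.dvd_sum fun m _ => ?_
    split_ifs with h
    · exact dvd_zero _
    · refine Dvd.dvd.mul_left ((pow_dvd_pow _ ?_).trans (pow_dvd_aperyTerm (t := 0) (r := r)
        Fact.out hlam (fun i => dvd_mul_right _ _) (by simpa using h))) _
      rw [Nat.sub_zero, mul_comm]
      exact Nat.mul_le_mul_left _ hl3
  choose c β hβ1 hβ2 using fun j => exists_blockTerm_tower (p := p) (hlam j) (hlam2 j)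
    (fun i => n (finSigmaFinEquiv ⟨j, i⟩))
  -- Each block satisfies the tower congruence up to the same reflection factor. With exactly two
  -- blocks this factor is squared and disappears.
  have htower := pow_dvd_sum_mul_of_tower (p := p) (fun i k => ((∏ j, β j i k : ℤ) : ℤ_[p])) (by
    intro i k
    rw [← toZModPow_eq_zero_iff, map_sub, map_intCast, map_intCast, sub_eq_zero]
    push_cast
    simp only [← hβ2]
    rw [Finset.prod_mul_distrib, Finset.prod_const, Finset.card_univ, Fintype.card_fin,
      ← Units.val_pow_eq_pow_val, primeFactorialMod, primeFactorialMod, ← map_mul, ← map_pow,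
      primeFactorial_mul_neg_one_sub_sq, map_one, Units.val_one, mul_one]) hK r 0 (signWeight p ε)
    (fun s _ M => by simpa using pow_dvd_sum_signWeight hp5 ε s M)
  rw [zero_add] at htower
  rw [← PadicInt.pow_p_dvd_int_iff]
  have hterm : ∀ m : ℤ, ((if (p : ℤ) ∣ m + 1 then 0 else
      ((ε ^ (m + 1) : ℤˣ) : ℤ) * aperyTerm lam ((p : ℤ) ^ r • n) (m + 1) : ℤ) : ℤ_[p]) =
      (p : ℤ_[p]) ^ (2 * r) * (∏ j, (c j : ℤ_[p])) *
        (((∏ j, β j r m : ℤ) : ℤ_[p]) * signWeight p ε m) := by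
    intro m
    rw [signWeight]
    split_ifs with h
    · rw [Ring.inverse_non_unit _ (mt PadicInt.isUnit_intCast_iff.mp (not_not.mpr h))]
      simp
    · have hu := Ring.inverse_mul_cancel _ (PadicInt.isUnit_intCast_iff.mpr h)
      have hb : ∀ j, (blockTerm (fun i => (p : ℤ) ^ r * n (finSigmaFinEquiv ⟨j, i⟩)) (m + 1) : ℤ_[p]) =
          Ring.inverse ((m + 1 : ℤ) : ℤ_[p]) * ((p : ℤ_[p]) ^ r * (c j * β j r m)) := by
        intro j
        have h1 := congrArg (Int.cast : ℤ → ℤ_[p]) (hβ1 j r m)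
        rw [Int.cast_mul] at h1
        push_cast at h1
        rw [← h1, ← mul_assoc]
        push_cast at hu
        push_cast
        rw [hu, one_mul]
      have hprod : (aperyTerm lam ((p : ℤ) ^ r • n) (m + 1) : ℤ_[p]) =
          ∏ j, (Ring.inverse ((m + 1 : ℤ) : ℤ_[p]) * ((p : ℤ_[p]) ^ r * (c j * β j r m))) := by
        rw [aperyTerm_eq_prod_blockTerm, Int.cast_prod]
        exact Finset.prod_congr rfl fun j _ => hb j
      rw [Int.cast_mul, hprod]
      simp only [Fin.prod_univ_two]
      push_cast
      ring
  rw [Int.cast_sum]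
  simp only [hterm]
  rw [← Finset.mul_sum, show 3 * r = 2 * r + r by ring, pow_add]
  exact mul_dvd_mul (dvd_mul_right _ _) htower

theorem pow_dvd_sum_aperyTerm {l : ℕ} (hl : 2 ≤ l) {lam : Fin l → ℕ}
    (hlam : ∀ j, 0 < lam j) (ε : ℤˣ) (n : Fin (∑ j, lam j) → ℤ) (r : ℕ) (s : Finset ℤ) :
    (p : ℤ) ^ (2 * r) ∣ ∑ m ∈ s, if (p : ℤ) ∣ m + 1 then 0 else
        ((ε ^ (m + 1) : ℤˣ) : ℤ) * aperyTerm lam ((p : ℤ) ^ r • n) (m + 1) := by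
  refine Finset.dvd_sum fun m _ => ?_
  split_ifs with h
  · exact dvd_zero _
  · refine Dvd.dvd.mul_left ((pow_dvd_pow _ ?_).trans (pow_dvd_aperyTerm (t := 0) (r := r)
      Fact.out hlam (fun i => dvd_mul_right _ _) (by simpa using h))) _
    rw [Nat.sub_zero, mul_comm]
    exact Nat.mul_le_mul_left _ hl

/-! ### Assembling the congruences -/

theorem sum_Ico_add_one_eq {M : Type*} [AddCommMonoid M] {Q : ℤ} {h : ℤ → M}
    (h1 : h (-Q) = 0) (h2 : h Q = 0) :
    ∑ k ∈ Finset.Ico (-Q) Q, h k = ∑ m ∈ Finset.Ico (-Q) Q, h (m + 1) := by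
  have h3 : ∑ m ∈ Finset.Ico (-Q) Q, h (m + 1) = ∑ k ∈ Finset.Ioc (-Q) Q, h k := by
    refine Finset.sum_nbij' (fun m => m + 1) (fun k => k - 1) ?_ ?_ ?_ ?_ ?_ <;>
      intro m hm <;> simp only [Finset.mem_Ico, Finset.mem_Ioc] at hm ⊢ <;> omega
  rw [h3]
  have h4 : ∑ k ∈ Finset.Ico (-Q) Q, h k = ∑ k ∈ Finset.Icc (-Q) Q, h k := by
    refine Finset.sum_subset Finset.Ico_subset_Icc_self fun x hx hx' => ?_
    rw [Finset.mem_Icc] at hx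
    rw [Finset.mem_Ico] at hx'
    rw [show x = Q by omega, h2]
  have h5 : ∑ k ∈ Finset.Ioc (-Q) Q, h k = ∑ k ∈ Finset.Icc (-Q) Q, h k := by
    refine Finset.sum_subset Finset.Ioc_subset_Icc_self fun x hx hx' => ?_
    rw [Finset.mem_Icc] at hx
    rw [Finset.mem_Ioc] at hx'
    rw [show x = -Q by omega, h1]
  rw [h4, h5]

theorem AperyFinite.exists_aperyA_eq_sum {l : ℕ} {lam : Fin l → ℕ} {n : Fin (∑ j, lam j) → ℤ}
    (h : AperyFinite lam n) (ε : ℤˣ) : ∃ B : ℤ, ∀ Q, B ≤ Q → aperyA lam ε n =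
      ∑ k ∈ Finset.Ico (-Q) Q, ((ε ^ k : ℤˣ) : ℤ) * aperyTerm lam n k := by
  obtain ⟨b, hb⟩ := h.bddAbove
  obtain ⟨a, ha⟩ := h.bddBelow
  refine ⟨max (b + 1) (-a), fun Q hQ => ?_⟩
  refine finsum_eq_sum_of_support_subset _ fun k hk => ?_
  have hk' : k ∈ {k : ℤ | aperyTerm lam n k ≠ 0} := right_ne_zero_of_mul hk
  have h1 := hb hk'
  have h2 := ha hk'
  rw [Finset.coe_Ico, Set.mem_Ico]
  omega

theorem aperyA_modEq {l : ℕ} {lam : Fin l → ℕ} (hlam : ∀ j, 0 < lam j) {ε : ℤˣ}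
    (hε : ε ^ p = ε) {n : Fin (∑ j, lam j) → ℤ} (hfin : AperyFinite lam n) {R E : ℕ}
    (h1 : ∀ k, (p : ℤ) ^ E ∣ aperyTerm lam ((p : ℤ) • (p : ℤ) ^ R • n) (p * k) -
      aperyTerm lam ((p : ℤ) ^ R • n) k)
    (h2 : ∀ K : ℤ, 0 ≤ K → (p : ℤ) ^ E ∣
      ∑ m ∈ Finset.Ico ((p ^ (R + 1) : ℕ) * -K) ((p ^ (R + 1) : ℕ) * K),
        if (p : ℤ) ∣ m + 1 then 0 else
          ((ε ^ (m + 1) : ℤˣ) : ℤ) * aperyTerm lam ((p : ℤ) ^ (R + 1) • n) (m + 1)) :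
    aperyA lam ε ((p : ℤ) ^ (R + 1) • n) ≡ aperyA lam ε ((p : ℤ) ^ R • n) [ZMOD (p : ℤ) ^ E] := by
  have hp : (0 : ℤ) < p := by exact_mod_cast (Fact.out : p.Prime).pos
  obtain ⟨B1, hB1⟩ := (hfin.smul hlam (by positivity : 0 ≤ (p : ℤ) ^ (R + 1))).exists_aperyA_eq_sum ε
  obtain ⟨B2, hB2⟩ := (hfin.smul hlam (by positivity : 0 ≤ (p : ℤ) ^ R)).exists_aperyA_eq_sum ε
  -- One `K` serves both levels: the ranges `± p ^ (R + 1) K` and `± p ^ R K` contain the supports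
  -- and correspond under `k ↦ p k`.
  set K : ℤ := max (max B1 B2) 0 with hK
  have hK0 : 0 ≤ K := le_max_right _ _
  have hle : ∀ i : ℕ, K ≤ (p ^ i : ℕ) * K := fun i =>
    le_mul_of_one_le_left hK0 (by exact_mod_cast Nat.one_le_pow _ _ (Fact.out : p.Prime).pos)
  rw [hB1 ((p ^ (R + 1) : ℕ) * K) (le_trans (by omega) (hle _)),
    hB2 ((p ^ R : ℕ) * K) (le_trans (by omega) (hle _))]
  set T := fun k : ℤ => ((ε ^ k : ℤˣ) : ℤ) * aperyTerm lam ((p : ℤ) ^ (R + 1) • n) k with hT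
  set Q : ℤ := (p ^ (R + 1) : ℕ) * K with hQ
  set Q' : ℤ := (p ^ R : ℕ) * K with hQ'
  have hQQ : Q = p * Q' := by rw [hQ, hQ']; push_cast; ring
  have hsplit : ∑ k ∈ Finset.Ico (-Q) Q, T k =
      (∑ k ∈ Finset.Ico (-Q) Q, if (p : ℤ) ∣ k then T k else 0) +
        ∑ k ∈ Finset.Ico (-Q) Q, if (p : ℤ) ∣ k then 0 else T k := by
    rw [← Finset.sum_add_distrib]
    refine Finset.sum_congr rfl fun k _ => ?_
    split_ifs <;> simp
  have hQ'0 : 0 ≤ Q' := by positivity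
  have hdiv : (∑ k ∈ Finset.Ico (-Q) Q, if (p : ℤ) ∣ k then T k else 0) =
      ∑ k ∈ Finset.Ico (-Q') Q', T (p * k) := by
    rw [hQQ, ← mul_neg, Finset.sum_Ico_natCast_mul p _ (by omega)]
    refine Finset.sum_congr rfl fun k _ => ?_
    rw [Finset.sum_eq_single_of_mem 0 (Finset.mem_range.mpr (by exact_mod_cast hp))]
    · simp
    · intro i hi hi0
      rw [Finset.mem_range] at hi
      rw [if_neg]
      rw [Int.dvd_add_right (dvd_mul_right _ _), Int.natCast_dvd_natCast]
      exact Nat.not_dvd_of_pos_of_lt (Nat.pos_of_ne_zero hi0) hi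
  have hpQ : (p : ℤ) ∣ Q := hQQ ▸ dvd_mul_right _ _
  -- Both end points are multiples of `p`, where the remaining summand is `0`, so the range may be
  -- shifted to `k = m + 1`.
  have hsecond := sum_Ico_add_one_eq (Q := Q)
    (h := fun k => if (p : ℤ) ∣ k then 0 else T k) (if_pos hpQ.neg_right) (if_pos hpQ)
  rw [hsplit, hdiv, hsecond, Int.modEq_comm, Int.modEq_iff_dvd, add_sub_right_comm,
    ← Finset.sum_sub_distrib]
  refine dvd_add (Finset.dvd_sum fun k _ => ?_) ?_
  · have h3 := h1 k
    rw [smul_smul, ← pow_succ'] at h3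
    simp only [hT]
    -- The signs at `p k` and `k` agree because `ε ^ p = ε`; for `p = 2` this forces `ε = 1`.
    rw [zpow_mul, zpow_natCast, hε, ← mul_sub]
    exact h3.mul_left _
  · have h3 := h2 K hK0
    rwa [mul_neg] at h3

end Padic

theorem theorem3p2 {l : ℕ} (hl : 2 ≤ l) (lam : Fin l → ℕ) (hlam : ∀ j, 0 < lam j)
    (ε : ℤˣ) (n : Fin (∑ j, lam j) → ℤ) (hfin : AperyFinite lam n) :
    (∀ m : ℕ, AperyFinite lam ((m : ℤ) • n)) ∧
    (∀ p : ℕ, p.Prime → (3 ≤ p ∨ (p = 2 ∧ ε = 1)) → ∀ r : ℕ, 1 ≤ r →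
      aperyA lam ε ((p : ℤ) ^ r • n) ≡ aperyA lam ε ((p : ℤ) ^ (r - 1) • n)
        [ZMOD (p : ℤ) ^ (2 * r)]) ∧
    ((∀ j, lam j ≤ 2) → ∀ p : ℕ, p.Prime → 5 ≤ p → ∀ r : ℕ, 1 ≤ r →
      aperyA lam ε ((p : ℤ) ^ r • n) ≡ aperyA lam ε ((p : ℤ) ^ (r - 1) • n)
        [ZMOD (p : ℤ) ^ (3 * r)]) := by
  have hodd : ∀ p : ℕ, p.Prime → 3 ≤ p → ε ^ p = ε := fun p hp h3 =>
    Int.units_pow_eq_pow_mod_two ε p |>.trans (by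
      rw [Nat.odd_iff.mp (hp.odd_of_ne_two (by omega)), pow_one])
  refine ⟨fun m => hfin.smul hlam (by positivity), fun p hp hp2 r hr => ?_,
    fun hlam2 p hp hp5 r hr => ?_⟩ <;>
  have : Fact p.Prime := ⟨hp⟩ <;>
  obtain ⟨R, rfl⟩ : ∃ R, r = R + 1 := ⟨r - 1, by omega⟩ <;>
  rw [Nat.add_sub_cancel]
  · refine aperyA_modEq hlam ?_ hfin
      (fun k => pow_dvd_aperyTerm_prime_mul_sub hl hlam (fun i => dvd_mul_right _ _) k)
      (fun K _ => pow_dvd_sum_aperyTerm hl hlam ε n (R + 1) _)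
    rcases hp2 with h3 | ⟨rfl, rfl⟩
    · exact hodd p hp h3
    · simp
  · exact aperyA_modEq hlam (hodd p hp (by omega)) hfin
      (fun k => pow_dvd_aperyTerm_prime_mul_sub_of_five_le hp5 hl hlam hlam2
        (fun i => dvd_mul_right _ _) k)
      (fun K hK => pow_dvd_sum_aperyTerm_of_five_le hp5 hl hlam hlam2 ε n (R + 1) hK)
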